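/- Notation. $\mathbb{B}^n$ is the set of binary strings of length $n$, and $\log$ is the binary logarithm. $C(x)$ is plain Kolmogorov complexity with respect to a fixed optimal decompressor: a partial computable map $V$ from strings to strings such that for every partial computable $W$ there is a constant $c$ with: whenever $W(p)=x$, there is $q$ with $V(q)=x$ and $|q|\le|p|+c$. Then $C(x)=\min\{|p| : V(p)=x\}$. $\mathbf{m}$ is a fixed discrete a priori probability, i.e. a lower semicomputable semimeasure on binary strings ($\mathbf m\ge 0$, $\sum_x\mathbf m(x)\le 1$, and the set of pairs $(r,x)$, $r$ rational, with $r<\mathbf m(x)$ is computably enumerable) that is maximal up to a constant factor among all such functions. Finite sets of strings are encoded by strings by a fixed injective computable encoding, and $C(A)$, $\mathbf{m}(A)$ denote the values of $C$, $\mathbf m$ at the code of $A$. Let $\mathcal{A}$ be an arbitrary decidable family of finite sets of binary strings (not necessarily containing the singletons), and let $\mathcal{A}^n$ be the family of those members of $\mathcal{A}$ that are subsets of $\mathbb{B}^n$. For $x\in\mathbb{B}^n$ and $A\in\mathcal A^n$ with $x\in A$ put $\delta(x,A)=C(A)+\log|A|-C(x)$. The $\mathcal{A}$-algorithmic prediction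 $d$-neighbourhood of $x\in\mathbb B^n$ is the union of all $A\in\mathcal{A}^n$ such that $x\in A$ and $\delta(x,A)\le\delta(x,B)+d$ for every $B\in\mathcal{A}^n$ containing $x$. The $\mathcal{A}$-probabilistic prediction $d$-neighbourhood of $x\in\mathbb B^n$ is the set of all strings $y$ with $p_{\mathcal{A}}(y\,|\,x)\ge 2^{-d}$, where $$p_{\mathcal{A}}(y\,|\,x)=\frac{\sum_{A\ni x,y}\mathbf{m}(A)/|A|}{\sum_{A\ni x}\mathbf{m}(A)/|A|},$$ both sums being over the sets $A\in\mathcal{A}^n$ with $C(A)\le 4n$ (and $p_{\mathcal{A}}(y\,|\,x)=0$ if no such set contains $x$). Theorem. There is a constant $c$, depending only on $\mathcal{A}$ and on the fixed choices of $V$, $\mathbf{m}$ and the encoding, such that: (a) for all sufficiently large $n$, every $x\in\mathbb{B}^n$ and every real $d$ (in particular every integer $d$), the $\mathcal{A}$-algorithmic prediction $d$-neighbourhood of $x$ is contained in the $\mathcal{A}$-probabilistic prediction $(d+c\log n)$-neighbourhood of $x$; (b) for all $n\ge 2$, every $x\in\mathbb{B}^n$ and every real $d$ (in particular every integer $d$),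 the $\mathcal{A}$-probabilistic prediction $d$-neighbourhood of $x$ is contained in the $\mathcal{A}$-algorithmic prediction $(d+c\log n)$-neighbourhood of $x$. In (a), the bound beyond which $n$ is sufficiently large also depends only on $\mathcal{A}$, $V$, $\mathbf{m}$ and the encoding. -/

import Mathlib

namespace AlgStat

/-- A decompressor `V` (a partial map from programs to outputs) is optimal if it is computable and,
for every other computable decompressor `W`, every `W`-description can be replaced by a
`V`-description that is longer by at most a constant. -/
def IsOptimalDecompressor (V : List Bool →. List Bool) : Prop :=
  Partrec V ∧
    ∀ W : List Bool →. List Bool, Partrec W →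
      ∃ c : ℕ, ∀ p x : List Bool, x ∈ W p → ∃ q : List Bool, x ∈ V q ∧ q.length ≤ p.length + c

/-- Plain Kolmogorov complexity `C(x)` with respect to `V`: the minimal length of a program
producing `x` (an optimal `V` has a program for every `x`, so the infimum is attained). -/
noncomputable def complexity (V : List Bool →. List Bool) (x : List Bool) : ℕ :=
  sInf {k : ℕ | ∃ p : List Bool, x ∈ V p ∧ p.length = k}

/-- Lower semicomputable semimeasures on binary strings. The rational numbers below `m x` are
enumerated in the form `a / (b + 1)` with natural `a` and `b`; negative rationals carry no
information, since `m` is non-negative. -/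
def IsLowerSemicomputableSemimeasure (m : List Bool → ℝ) : Prop :=
  (∀ x, 0 ≤ m x) ∧ Summable m ∧ ∑' x, m x ≤ 1 ∧
    REPred fun t : (ℕ × ℕ) × List Bool => (t.1.1 : ℝ) / ((t.1.2 : ℝ) + 1) < m t.2

/-- `m` is a discrete a priori probability: a lower semicomputable semimeasure that is maximal up to
a constant factor. -/
def IsAPrioriProbability (m : List Bool → ℝ) : Prop :=
  IsLowerSemicomputableSemimeasure m ∧
    ∀ μ : List Bool → ℝ, IsLowerSemicomputableSemimeasure μ →
      ∃ c : ℝ, 0 < c ∧ ∀ x, μ x ≤ c * m x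

/-- A computable encoding of finite sets of binary strings by binary strings: distinct sets have
distinct codes, and the code can be computed from any list of the elements of the set. -/
def IsComputableEncoding (enc : Finset (List Bool) → List Bool) : Prop :=
  Function.Injective enc ∧ Computable fun L : List (List Bool) => enc L.toFinset

/-- A family of finite sets of binary strings is decidable if there is an algorithm that, given a
list of the elements of a finite set, decides whether the set belongs to the family. -/
def IsDecidableFamily (𝒜 : Set (Finset (List Bool))) : Prop :=
  ComputablePred fun L : List (List Bool) => L.toFinset ∈ 𝒜

/-- The set `𝔹ⁿ` of all binary strings of length `n`. -/
def bitStrings (n : ℕ) : Finset (List Bool) :=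
  (Finset.univ : Finset (List.Vector Bool n)).image List.Vector.toList

theorem mem_bitStrings {n : ℕ} {x : List Bool} : x ∈ bitStrings n ↔ x.length = n := by
  constructor
  · intro h
    obtain ⟨v, -, rfl⟩ := Finset.mem_image.1 h
    exact v.toList_length
  · intro h
    exact Finset.mem_image.2 ⟨⟨x, h⟩, Finset.mem_univ _, rfl⟩

open Classical in
/-- `𝒜ⁿ`: the members of `𝒜` that are subsets of `𝔹ⁿ`. -/
noncomputable def slice (𝒜 : Set (Finset (List Bool))) (n : ℕ) : Finset (Finset (List Bool)) :=
  (bitStrings n).powerset.filter fun A => A ∈ 𝒜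

theorem mem_slice {𝒜 : Set (Finset (List Bool))} {n : ℕ} {A : Finset (List Bool)} :
    A ∈ slice 𝒜 n ↔ A ∈ 𝒜 ∧ ∀ a ∈ A, a.length = n := by
  classical
  simp only [slice, Finset.mem_filter, Finset.mem_powerset, Finset.subset_iff, mem_bitStrings]
  exact and_comm

/-- The optimality deficiency `δ(x, A) = C(A) + log₂ |A| - C(x)`. -/
noncomputable def deficiency (V : List Bool →. List Bool) (enc : Finset (List Bool) → List Bool)
    (x : List Bool) (A : Finset (List Bool)) : ℝ :=
  (complexity V (enc A) : ℝ) + Real.logb 2 (A.card : ℝ) - (complexity V x : ℝ)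

/-- The `𝒜`-algorithmic prediction `d`-neighbourhood of `x`: the union of all `A ∈ 𝒜ⁿ` containing
`x`, `n = |x|`, with `δ(x, A) ≤ δ(x, B) + d` for every `B ∈ 𝒜ⁿ` containing `x`. -/
def algNeighborhood (V : List Bool →. List Bool) (enc : Finset (List Bool) → List Bool)
    (𝒜 : Set (Finset (List Bool))) (d : ℝ) (x : List Bool) : Set (List Bool) :=
  {y | ∃ A ∈ slice 𝒜 x.length, x ∈ A ∧ y ∈ A ∧
    ∀ B ∈ slice 𝒜 x.length, x ∈ B → deficiency V enc x A ≤ deficiency V enc x B + d}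

open Classical in
/-- The sum of `m(A) / |A|` over all `A ∈ 𝒜ⁿ` of complexity at most `4 n` that contain every
element of `S`. -/
noncomputable def modelSum (V : List Bool →. List Bool) (m : List Bool → ℝ)
    (enc : Finset (List Bool) → List Bool) (𝒜 : Set (Finset (List Bool))) (n : ℕ)
    (S : Set (List Bool)) : ℝ :=
  ∑ A ∈ (slice 𝒜 n).filter (fun A => complexity V (enc A) ≤ 4 * n ∧ ∀ s ∈ S, s ∈ A),
    m (enc A) / (A.card : ℝ)

/-- The conditional probability `p_𝒜(y | x)`. If no set in the sums contains `x`, then `x` cannot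
be an outcome of the two-stage process, and the value is `0 / 0 = 0`. -/
noncomputable def predictionProb (V : List Bool →. List Bool) (m : List Bool → ℝ)
    (enc : Finset (List Bool) → List Bool) (𝒜 : Set (Finset (List Bool)))
    (y x : List Bool) : ℝ :=
  modelSum V m enc 𝒜 x.length {x, y} / modelSum V m enc 𝒜 x.length {x}

/-- The `𝒜`-probabilistic prediction `d`-neighbourhood of `x`: all `y` with
`p_𝒜(y | x) ≥ 2 ^ (-d)`. It is empty if no set in the sums contains `x`. -/
def probNeighborhood (V : List Bool →. List Bool) (m : List Bool → ℝ)
    (enc : Finset (List Bool) → List Bool) (𝒜 : Set (Finset (List Bool))) (d : ℝ)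
    (x : List Bool) : Set (List Bool) :=
  {y | (2 : ℝ) ^ (-d) ≤ predictionProb V m enc 𝒜 y x}

end AlgStat

/-! Put w(A) = 2^(-C(A)) / |A| (`modelWeight`). In a difference of deficiencies C(x) cancels, so A
is within d of the best model of x exactly when w(B) ≤ 2^d w(A) for every competitor B
(`deficiency_le_iff`). Both inclusions therefore reduce to one claim: up to a factor polynomial in
n, which becomes the term c log n, the sum of m(A)/|A| over the models containing x and y equals the
largest w(A) among them.

One direction is the easy half of the coding theorem, m(A) ≥ 2^(-C(A)) / poly(C(A))
(`exists_le_apriori`). Models of complexity above 4n are missing from the sum, but for large n this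
is harmless: a search started from x and y finds a common model of complexity 2n + O(1), whose
weight is at least as large (`exists_better_model`).

The other direction, `exists_modelSum_le`, must exclude that many complex models jointly outweigh
every simple one. Up to the factor n + 1 the sum comes from models of size about 2^l for a single l.
Enumerate the models of size at most 2^(l+1), each A in about 2^(10n) m(A) copies, hence at most
2^(10n) copies in all, and view a copy as the set A × A of pairs. Suppose (x, y) lies in about 2^q
(13n + 2) copies. An online rule marks at most 1 + 2^(10n-q) of them and still covers every pair
that lies in that many copies. A marked set is determined by n, l, q and its position in the order
of marking, so its complexity is at most 10n - q + O(log n); its 2^(-C) thus matches the total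
m-mass up to a polynomial factor. The marking rule is a derandomised random choice, controlled by a
potential function (`sum_realWeight_add_le`) and turned into a complexity bound in
`exists_cover_complexity_le`. -/

namespace AlgStat

/-! ### Recursively enumerable predicates -/

section RE

variable {α β σ : Type*} [Primcodable α] [Primcodable β] [Primcodable σ]

open Encodable in
/-- A recursively enumerable predicate has primitive recursive witnesses. -/
theorem exists_primrec_of_rePred {p : α → Prop} (hp : REPred p) :
    ∃ f : α → ℕ → Bool, Primrec₂ f ∧ ∀ a, p a ↔ ∃ n, f a n = true := by
  obtain ⟨c, hc⟩ := Nat.Partrec.Code.exists_code.1 hp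
  refine ⟨fun a n => (Nat.Partrec.Code.evaln n c (encode a)).isSome, ?_, fun a => ?_⟩
  · exact Primrec.option_isSome.comp (Nat.Partrec.Code.primrec_evaln.comp
      (Primrec.pair (Primrec.pair Primrec.snd (Primrec.const c))
        (Primrec.encode.comp Primrec.fst)))
  · have h1 : p a ↔ (Nat.Partrec.Code.eval c (encode a)).Dom := by
      rw [hc]
      simp [Part.assert]
    rw [h1, Part.dom_iff_mem]
    simp only [Nat.Partrec.Code.evaln_complete, Option.isSome_iff_exists, Option.mem_def]
    exact exists_comm

theorem rePred_of_computable {f : α → ℕ → Bool} (hf : Computable₂ f) :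
    REPred fun a => ∃ n, f a n = true := by
  have h : Partrec fun a => Nat.rfind fun n => Part.some (f a n) :=
    Partrec.rfind hf.partrec₂
  refine (Partrec.dom_re h).of_eq fun a => ?_
  refine Nat.rfind_dom'.trans ?_
  constructor
  · rintro ⟨n, hn, -⟩
    exact ⟨n, by simpa using hn⟩
  · rintro ⟨n, hn⟩
    exact ⟨n, by simpa using hn, fun _ => trivial⟩

theorem rePred_comp {p : β → Prop} (hp : REPred p) {g : α → β} (hg : Computable g) :
    REPred fun a => p (g a) :=
  Partrec.comp hp hg

/-- The sections of a recursively enumerable relation are enumerated uniformly. -/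
theorem exists_primrec_enum {p : α → β → Prop} (hp : REPred fun x : α × β => p x.1 x.2) :
    ∃ h : α → ℕ → Option β, Primrec₂ h ∧ ∀ a b, p a b ↔ ∃ n, h a n = some b := by
  obtain ⟨f, hf, hpf⟩ := exists_primrec_of_rePred hp
  -- A stage `n` unpairs into a guessed element and a candidate witness for it.
  refine ⟨fun a n => (Encodable.decode (α := β) n.unpair.1).bind fun b =>
    if f (a, b) n.unpair.2 = true then some b else none, ?_, fun a b => ?_⟩
  · refine Primrec.option_bind (Primrec.decode.comp (Primrec.fst.comp
      (Primrec.unpair.comp Primrec.snd))) ?_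
    refine Primrec.ite (Primrec.eq.comp (hf.comp (Primrec.pair (Primrec.fst.comp Primrec.fst)
      Primrec.snd) (Primrec.snd.comp (Primrec.unpair.comp (Primrec.snd.comp Primrec.fst))))
      (Primrec.const true)) (Primrec.option_some.comp Primrec.snd) (Primrec.const none)
  · rw [hpf (a, b)]
    constructor
    · rintro ⟨n, hn⟩
      exact ⟨Nat.pair (Encodable.encode b) n, by simp [hn]⟩
    · rintro ⟨n, hn⟩
      obtain ⟨b', -, h'⟩ := Option.bind_eq_some_iff.1 hn
      split_ifs at h' with h
      cases h'
      exact ⟨_, h⟩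

theorem rePred_exists {p : α → β → Prop} (hp : REPred fun x : α × β => p x.1 x.2) :
    REPred fun a => ∃ b, p a b := by
  obtain ⟨h, hh, hph⟩ := exists_primrec_enum hp
  refine (rePred_of_computable (f := fun a n => (h a n).isSome)
    (Primrec.option_isSome.comp hh).to_comp).of_eq fun a => ?_
  simp only [hph, Option.isSome_iff_exists]
  exact exists_comm

theorem rePred_and {p q : α → Prop} (hp : REPred p) (hq : REPred q) :
    REPred fun a => p a ∧ q a := by
  obtain ⟨f, hf, hpf⟩ := exists_primrec_of_rePred hp
  obtain ⟨g, hg, hqg⟩ := exists_primrec_of_rePred hq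
  refine (rePred_of_computable (f := fun a n => f a n.unpair.1 && g a n.unpair.2)
    ?_).of_eq fun a => ?_
  · exact (Primrec.and.comp
      (hf.comp Primrec.fst (Primrec.fst.comp (Primrec.unpair.comp Primrec.snd)))
      (hg.comp Primrec.fst (Primrec.snd.comp (Primrec.unpair.comp Primrec.snd)))).to_comp
  · rw [hpf, hqg]
    constructor
    · rintro ⟨n, hn⟩
      rw [Bool.and_eq_true] at hn
      exact ⟨⟨_, hn.1⟩, ⟨_, hn.2⟩⟩
    · rintro ⟨⟨i, hi⟩, ⟨j, hj⟩⟩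
      exact ⟨Nat.pair i j, by simp [hi, hj]⟩

theorem rePred_of_primrecPred {p : α → Prop} (hp : PrimrecPred p) : REPred p :=
  hp.computablePred.to_re

theorem rePred_eq {f g : α → β} (hf : Computable f) (hg : Computable g) :
    REPred fun a => f a = g a := by
  classical
  exact rePred_comp (p := fun x : β × β => x.1 = x.2)
    (rePred_of_primrecPred (Primrec.eq.comp Primrec.fst Primrec.snd)) (hf.pair hg)

/-- A recursively enumerable relation contains the graph of a partial computable function with
the same domain. -/
theorem exists_partrec_selector {p : α → β → Prop} (hp : REPred fun x : α × β => p x.1 x.2) :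
    ∃ g : α →. β, Partrec g ∧ (∀ a b, b ∈ g a → p a b) ∧ ∀ a b, p a b → ∃ b', b' ∈ g a := by
  obtain ⟨h, hh, hph⟩ := exists_primrec_enum hp
  refine ⟨fun a => Nat.rfindOpt (h a), Partrec.rfindOpt hh.to_comp, fun a b hb => ?_,
    fun a b hab => ?_⟩
  · obtain ⟨n, hn⟩ := Nat.rfindOpt_spec hb
    exact (hph a b).2 ⟨n, hn⟩
  · obtain ⟨n, hn⟩ := (hph a b).1 hab
    exact Part.dom_iff_mem.1 (Nat.rfindOpt_dom.2 ⟨n, b, hn⟩)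

/-- The graph of a partial computable function is recursively enumerable. -/
theorem rePred_graph {f : α →. β} (hf : Partrec f) : REPred fun x : α × β => x.2 ∈ f x.1 := by
  classical
  have h : Partrec fun x : α × β => (f x.1).bind fun y =>
      ((if y = x.2 then some () else none : Option Unit) : Part Unit) := by
    refine Partrec.bind (hf.comp Computable.fst) ?_
    refine Computable.ofOption ?_
    exact (Primrec.ite (Primrec.eq.comp Primrec.snd (Primrec.snd.comp Primrec.fst))
      (Primrec.const (some ())) (Primrec.const none)).to_comp
  refine (Partrec.dom_re h).of_eq fun x => ?_
  rw [Part.dom_iff_mem]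
  constructor
  · rintro ⟨u, hu⟩
    obtain ⟨y, hy, hu⟩ := Part.mem_bind_iff.1 hu
    split_ifs at hu with h
    · exact h ▸ hy
    · simp at hu
  · intro hx
    exact ⟨(), Part.mem_bind_iff.2 ⟨_, hx, by simp⟩⟩

end RE

/-! ### Basic facts about complexity -/

theorem exists_program {V : List Bool →. List Bool} (hV : IsOptimalDecompressor V)
    (x : List Bool) : ∃ p, x ∈ V p ∧ p.length = complexity V x := by
  -- Comparison with the identity decompressor gives every string some program.
  obtain ⟨c, hc⟩ := hV.2 (fun p => Part.some p) Partrec.some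
  obtain ⟨q, hq, -⟩ := hc x x (Part.mem_some x)
  exact Nat.sInf_mem (s := {k : ℕ | ∃ p : List Bool, x ∈ V p ∧ p.length = k}) ⟨_, q, hq, rfl⟩

theorem complexity_le {V : List Bool →. List Bool} {x p : List Bool} (h : x ∈ V p) :
    complexity V x ≤ p.length :=
  Nat.sInf_le ⟨p, h, rfl⟩

theorem complexity_le_of_partrec {V : List Bool →. List Bool} (hV : IsOptimalDecompressor V)
    {W : List Bool →. List Bool} (hW : Partrec W) :
    ∃ c : ℕ, ∀ p x, x ∈ W p → complexity V x ≤ p.length + c := by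
  obtain ⟨c, hc⟩ := hV.2 W hW
  refine ⟨c, fun p x hx => ?_⟩
  obtain ⟨q, hq, hl⟩ := hc p x hx
  exact (complexity_le hq).trans hl

theorem card_bitStrings (n : ℕ) : (bitStrings n).card = 2 ^ n := by
  rw [bitStrings, Finset.card_image_of_injective _ List.Vector.toList_injective, Finset.card_univ,
    card_vector, Fintype.card_bool]

/-- Choosing a shortest program for each string is injective. -/
theorem card_complexity_eq_le {V : List Bool →. List Bool} (hV : IsOptimalDecompressor V)
    (s : Finset (List Bool)) (k : ℕ) :
    (s.filter fun x => complexity V x = k).card ≤ 2 ^ k := by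
  choose p hp hl using exists_program hV
  rw [← card_bitStrings]
  refine Finset.card_le_card_of_injOn p (fun x hx => ?_) (fun x _ y _ hxy => ?_)
  · exact mem_bitStrings.2 ((hl x).trans (Finset.mem_filter.1 hx).2)
  · exact Part.mem_unique (hp x) (hxy ▸ hp y)

theorem card_complexity_le {V : List Bool →. List Bool} (hV : IsOptimalDecompressor V)
    (s : Finset (List Bool)) (k : ℕ) (hs : ∀ x ∈ s, complexity V x ≤ k) :
    s.card ≤ 2 ^ (k + 1) := by
  rw [Finset.card_eq_sum_card_fiberwise (f := complexity V) (t := Finset.range (k + 1))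
    (fun x hx => Finset.mem_coe.2 (Finset.mem_range.2 (Nat.lt_succ_of_le (hs x hx))))]
  refine (Finset.sum_le_sum fun i _ => card_complexity_eq_le hV s i).trans ?_
  have := Nat.geomSum_eq (le_refl 2) (k + 1)
  rw [this]
  simp

/-! ### Descriptions by pairs -/

/-- The self-delimiting concatenation of `u` and `v`: the unary length of `u`, then `u`, `v`. -/
def joinCode (x : List Bool × List Bool) : List Bool :=
  x.1.map (fun _ => true) ++ false :: (x.1 ++ x.2)

theorem primrec_joinCode : Primrec joinCode :=
  Primrec.list_append.comp (Primrec.list_map Primrec.fst (Primrec.const true).to₂)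
    (Primrec.list_cons.comp (Primrec.const false)
      (Primrec.list_append.comp Primrec.fst Primrec.snd))

theorem length_joinCode (u v : List Bool) :
    (joinCode (u, v)).length = 2 * u.length + v.length + 1 := by
  simp [joinCode]; ring

theorem joinCode_injective : Function.Injective joinCode := by
  have key : ∀ k l : ℕ, ∀ s t : List Bool,
      List.replicate k true ++ false :: s = List.replicate l true ++ false :: t →
        k = l ∧ s = t := by
    intro k
    induction k with
    | zero =>
      intro l s t h
      cases l with
      | zero => simpa using h
      | succ l => simp [List.replicate_succ] at h
    | succ k ih =>
      intro l s t h
      cases l with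
      | zero => simp [List.replicate_succ] at h
      | succ l =>
        simp only [List.replicate_succ, List.cons_append, List.cons.injEq, true_and] at h
        have := ih l s t h
        exact ⟨by rw [this.1], this.2⟩
  rintro ⟨u, v⟩ ⟨u', v'⟩ h
  simp only [joinCode, List.map_const'] at h
  obtain ⟨hl, h⟩ := key _ _ _ _ h
  obtain ⟨h1, h2⟩ := List.append_inj h hl
  rw [h1, h2]

/-- The number with the given binary digits, least significant digit first. -/
def ofBits (l : List Bool) : ℕ := l.foldr Nat.bit 0

theorem primrec_ofBits : Primrec ofBits := by
  refine Primrec.list_foldr (f := fun l : List Bool => l) (g := fun _ => 0)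
    (h := fun _ x => Nat.bit x.1 x.2) Primrec.id (Primrec.const 0) ?_
  have h : Primrec fun x : List Bool × (Bool × ℕ) =>
      bif x.2.1 then 2 * x.2.2 + 1 else 2 * x.2.2 :=
    Primrec.cond (Primrec.fst.comp Primrec.snd)
      (Primrec.nat_double_succ.comp (Primrec.snd.comp Primrec.snd))
      (Primrec.nat_double.comp (Primrec.snd.comp Primrec.snd))
  exact h.of_eq fun x => by rcases x with ⟨_, b, n⟩; cases b <;> rfl

theorem ofBits_bits (n : ℕ) : ofBits n.bits = n := by
  induction n using Nat.binaryRec' with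
  | zero => simp [ofBits]
  | bit b n h ih =>
    rw [Nat.bits_append_bit n b h]
    show Nat.bit b (ofBits n.bits) = _
    rw [ih]

/-- An object that is determined computably by two numbers is described by their binary
expansions, the first of them in self-delimiting form. -/
theorem complexity_le_of_rePred {V : List Bool →. List Bool} (hV : IsOptimalDecompressor V)
    {p : ℕ × ℕ → List Bool → Prop}
    (hp : REPred fun x : (ℕ × ℕ) × List Bool => p x.1 x.2)
    (hf : ∀ a z z', p a z → p a z' → z = z') :
    ∃ c : ℕ, ∀ a b z, p (a, b) z → complexity V z ≤ 2 * a.size + b.size + c := by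
  have h1 : REPred fun x : List Bool × List Bool => ∃ w : List Bool × List Bool,
      x.1 = joinCode w ∧ p (ofBits w.1, ofBits w.2) x.2 := by
    refine rePred_exists (p := fun (x w : List Bool × List Bool) =>
      x.1 = joinCode w ∧ p (ofBits w.1, ofBits w.2) x.2) (rePred_and ?_ ?_)
    · exact rePred_eq (Computable.fst.comp Computable.fst)
        (primrec_joinCode.to_comp.comp Computable.snd)
    · exact rePred_comp hp (g := fun y : (List Bool × List Bool) × (List Bool × List Bool) =>
        ((ofBits y.2.1, ofBits y.2.2), y.1.2))
        (((primrec_ofBits.comp (Primrec.fst.comp Primrec.snd)).pair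
          (primrec_ofBits.comp (Primrec.snd.comp Primrec.snd))).pair
            (Primrec.snd.comp Primrec.fst)).to_comp
  obtain ⟨W, hW, hW1, hW2⟩ := exists_partrec_selector (p := fun q z => ∃ w : List Bool × List Bool,
      q = joinCode w ∧ p (ofBits w.1, ofBits w.2) z) h1
  obtain ⟨c, hc⟩ := complexity_le_of_partrec hV hW
  refine ⟨c + 1, fun a b z hz => ?_⟩
  have h2 : p (ofBits a.bits, ofBits b.bits) z := by rwa [ofBits_bits, ofBits_bits]
  -- The selector returns some output; unique parsing of `joinCode` and functionality of `p` force
  -- it to be `z`.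
  obtain ⟨z', hz'⟩ := hW2 (joinCode (a.bits, b.bits)) z ⟨_, rfl, h2⟩
  obtain ⟨w, hw, hw'⟩ := hW1 _ _ hz'
  have := joinCode_injective hw
  subst this
  obtain rfl := hf _ _ _ h2 hw'
  have := hc _ _ hz'
  rw [length_joinCode, Nat.size_eq_bits_len, Nat.size_eq_bits_len] at this
  omega

/-! ### A lower bound for the a priori probability -/

/-- The semimeasure that assigns `2 ^ (-C(x)) / ((C(x) + 1) (C(x) + 2))` to `x`. -/
noncomputable def complexityMeasure (V : List Bool →. List Bool) (x : List Bool) : ℝ :=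
  1 / ((2 ^ complexity V x * ((complexity V x + 1) * (complexity V x + 2)) : ℕ) : ℝ)

/-- At most 2^k strings have complexity k, so level k contributes at most 1/((k+1)(k+2)), and these
bounds telescope. -/
theorem sum_complexityMeasure_le {V : List Bool →. List Bool} (hV : IsOptimalDecompressor V)
    (s : Finset (List Bool)) : ∑ x ∈ s, complexityMeasure V x ≤ 1 := by
  obtain ⟨K, hK⟩ : ∃ K, ∀ x ∈ s, complexity V x < K := by
    refine ⟨s.sup (complexity V) + 1, fun x hx => Nat.lt_succ_of_le (Finset.le_sup hx)⟩
  rw [← Finset.sum_fiberwise_of_maps_to (g := complexity V) (t := Finset.range K)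
    (fun x hx => Finset.mem_range.2 (hK x hx))]
  have h1 : ∀ k ∈ Finset.range K, ∑ x ∈ s with complexity V x = k, complexityMeasure V x ≤
      1 / ((k : ℝ) + 1) - 1 / ((k + 1 : ℕ) + 1 : ℝ) := by
    intro k _
    have h2 : ∑ x ∈ s with complexity V x = k, complexityMeasure V x =
        ((s.filter fun x => complexity V x = k).card : ℝ) *
          (1 / ((2 ^ k * ((k + 1) * (k + 2)) : ℕ) : ℝ)) := by
      rw [← nsmul_eq_mul, ← Finset.sum_const]
      refine Finset.sum_congr rfl fun x hx => ?_
      rw [complexityMeasure, (Finset.mem_filter.1 hx).2]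
    rw [h2]
    have h3 : ((s.filter fun x => complexity V x = k).card : ℝ) ≤ 2 ^ k := by
      exact_mod_cast card_complexity_eq_le hV s k
    calc _ ≤ (2 : ℝ) ^ k * (1 / ((2 ^ k * ((k + 1) * (k + 2)) : ℕ) : ℝ)) := by gcongr
      _ = _ := by push_cast; field_simp; ring
  refine (Finset.sum_le_sum h1).trans ?_
  rw [Finset.sum_range_sub' (fun k : ℕ => 1 / ((k : ℝ) + 1))]
  have : 0 ≤ 1 / ((K : ℝ) + 1) := by positivity
  simp only [Nat.cast_zero, zero_add, div_one]
  linarith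

theorem primrec₂_pow : Primrec₂ ((· ^ ·) : ℕ → ℕ → ℕ) :=
  Primrec₂.unpaired'.1 Nat.Primrec.pow

/-- Replacing C(x) by the length of any program of x only lowers the value, so a strict lower bound
holds exactly when some program confirms it. -/
theorem isLowerSemicomputableSemimeasure_complexityMeasure {V : List Bool →. List Bool}
    (hV : IsOptimalDecompressor V) :
    IsLowerSemicomputableSemimeasure (complexityMeasure V) := by
  have h0 : ∀ x, 0 ≤ complexityMeasure V x := fun x => by unfold complexityMeasure; positivity
  have hs : Summable (complexityMeasure V) :=
    summable_of_sum_le h0 (sum_complexityMeasure_le hV)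
  refine ⟨h0, hs, hs.tsum_le_of_sum_le (sum_complexityMeasure_le hV), ?_⟩
  have h1 : REPred fun t : (ℕ × ℕ) × List Bool => ∃ q : List Bool, t.2 ∈ V q ∧
      t.1.1 * (2 ^ q.length * ((q.length + 1) * (q.length + 2))) < t.1.2 + 1 := by
    refine rePred_exists (p := fun (t : (ℕ × ℕ) × List Bool) (q : List Bool) => t.2 ∈ V q ∧
      t.1.1 * (2 ^ q.length * ((q.length + 1) * (q.length + 2))) < t.1.2 + 1) (rePred_and ?_ ?_)
    · exact rePred_comp (p := fun x : List Bool × List Bool => x.2 ∈ V x.1) (rePred_graph hV.1)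
        (g := fun x : ((ℕ × ℕ) × List Bool) × List Bool => (x.2, x.1.2))
        (Computable.snd.pair (Computable.snd.comp Computable.fst))
    · have hl : Primrec fun x : ((ℕ × ℕ) × List Bool) × List Bool => x.2.length :=
        Primrec.list_length.comp Primrec.snd
      refine rePred_of_primrecPred (Primrec.nat_lt.comp ?_ ?_)
      · refine Primrec.nat_mul.comp (Primrec.fst.comp (Primrec.fst.comp Primrec.fst))
          (Primrec.nat_mul.comp (primrec₂_pow.comp (Primrec.const 2) hl) (Primrec.nat_mul.comp
            (Primrec.nat_add.comp hl (Primrec.const 1))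
            (Primrec.nat_add.comp hl (Primrec.const 2))))
      · exact Primrec.succ.comp (Primrec.snd.comp (Primrec.fst.comp Primrec.fst))
  refine h1.of_eq fun t => ?_
  have h2 : (t.1.1 : ℝ) / ((t.1.2 : ℝ) + 1) < complexityMeasure V t.2 ↔
      t.1.1 * (2 ^ complexity V t.2 * ((complexity V t.2 + 1) * (complexity V t.2 + 2))) <
        t.1.2 + 1 := by
    rw [complexityMeasure, div_lt_div_iff₀ (by positivity) (by positivity)]
    norm_cast
    rw [one_mul]
  rw [h2]
  constructor
  · rintro ⟨q, hq, hlt⟩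
    have := complexity_le hq
    refine lt_of_le_of_lt ?_ hlt
    gcongr
    norm_num
  · intro h
    obtain ⟨q, hq, hl⟩ := exists_program hV t.2
    exact ⟨q, hq, by rw [hl]; exact h⟩

/-- The easy half of the coding theorem, up to a polynomial factor. -/
theorem exists_le_apriori {V : List Bool →. List Bool} (hV : IsOptimalDecompressor V)
    {m : List Bool → ℝ} (hm : IsAPrioriProbability m) :
    ∃ c : ℝ, 0 < c ∧ ∀ x, 1 / (2 ^ complexity V x : ℝ) ≤
      c * ((complexity V x + 1) * (complexity V x + 2)) * m x := by
  obtain ⟨c, hc, h⟩ := hm.2 _ (isLowerSemicomputableSemimeasure_complexityMeasure hV)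
  refine ⟨c, hc, fun x => ?_⟩
  have := h x
  rw [complexityMeasure] at this
  push_cast at this
  rw [div_le_iff₀ (by positivity)] at this ⊢
  linarith

/-! ### Members of a decidable family -/

/-- `L` lists the elements of a member of `𝒜ⁿ` with code `z`. -/
def ListsModel (enc : Finset (List Bool) → List Bool) (𝒜 : Set (Finset (List Bool))) (n : ℕ)
    (z : List Bool) (L : List (List Bool)) : Prop :=
  z = enc L.toFinset ∧ L.toFinset ∈ 𝒜 ∧ ∀ s ∈ L, s.length = n

theorem rePred_listsModel {enc : Finset (List Bool) → List Bool} (henc : IsComputableEncoding enc)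
    {𝒜 : Set (Finset (List Bool))} (h𝒜 : IsDecidableFamily 𝒜) :
    REPred fun x : (ℕ × List Bool) × List (List Bool) => ListsModel enc 𝒜 x.1.1 x.1.2 x.2 := by
  refine rePred_and ?_ (rePred_and ?_ ?_)
  · exact rePred_eq (Computable.snd.comp Computable.fst) (henc.2.comp Computable.snd)
  · exact rePred_comp (p := fun L : List (List Bool) => L.toFinset ∈ 𝒜) h𝒜.to_re Computable.snd
  · refine rePred_of_primrecPred ?_
    have h : PrimrecRel fun (s : List Bool) (n : ℕ) => s.length = n :=
      Primrec.eq.comp (Primrec.list_length.comp Primrec.fst) Primrec.snd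
    exact h.forall_mem_list.comp Primrec.snd (Primrec.fst.comp Primrec.fst)

theorem ListsModel.mem_slice {enc : Finset (List Bool) → List Bool}
    {𝒜 : Set (Finset (List Bool))} {n : ℕ} {z : List Bool} {L : List (List Bool)}
    (h : ListsModel enc 𝒜 n z L) : L.toFinset ∈ slice 𝒜 n :=
  AlgStat.mem_slice.2 ⟨h.2.1, fun a ha => h.2.2 a (List.mem_toFinset.1 ha)⟩

theorem listsModel_toList (enc : Finset (List Bool) → List Bool)
    {𝒜 : Set (Finset (List Bool))} {n : ℕ} {A : Finset (List Bool)} (hA : A ∈ slice 𝒜 n) :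
    ListsModel enc 𝒜 n (enc A) A.toList := by
  rw [AlgStat.mem_slice] at hA
  refine ⟨by rw [Finset.toList_toFinset], by rw [Finset.toList_toFinset]; exact hA.1,
    fun s hs => hA.2 s (Finset.mem_toList.1 hs)⟩

theorem primrecRel_mem {α : Type*} [Primcodable α] : PrimrecRel fun (a : α) (L : List α) => a ∈ L := by
  have h : PrimrecRel fun (L : List α) (a : α) => ∃ b ∈ L, b = a :=
    (Primrec.eq (α := α)).exists_mem_list
  exact h.swap.of_eq fun a L => by simp [Function.swap]

/-- Two strings of length `n` that lie in a common member of `𝒜ⁿ` lie in a common member of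
complexity at most `2 n + O(1)`. -/
theorem exists_common_model_complexity_le {V : List Bool →. List Bool}
    (hV : IsOptimalDecompressor V) {enc : Finset (List Bool) → List Bool}
    (henc : IsComputableEncoding enc) {𝒜 : Set (Finset (List Bool))}
    (h𝒜 : IsDecidableFamily 𝒜) :
    ∃ c : ℕ, ∀ n, ∀ A ∈ slice 𝒜 n, ∀ x ∈ A, ∀ y ∈ A, ∃ B ∈ slice 𝒜 n, x ∈ B ∧ y ∈ B ∧
      complexity V (enc B) ≤ 2 * n + c := by
  let r : List Bool × List Bool → (List Bool × List Bool) × List (List Bool) → Prop :=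
    fun x w => (x.1 = w.1.1 ++ w.1.2 ∧ w.1.1.length = w.1.2.length) ∧
      ListsModel enc 𝒜 w.1.1.length x.2 w.2 ∧ w.1.1 ∈ w.2 ∧ w.1.2 ∈ w.2
  have hr : REPred fun x : List Bool × List Bool => ∃ w, r x w := by
    have h1 : Primrec fun x : (List Bool × List Bool) × ((List Bool × List Bool) ×
        List (List Bool)) => x.2.1.1 := Primrec.fst.comp (Primrec.fst.comp Primrec.snd)
    have h2 : Primrec fun x : (List Bool × List Bool) × ((List Bool × List Bool) ×
        List (List Bool)) => x.2.1.2 := Primrec.snd.comp (Primrec.fst.comp Primrec.snd)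
    have h3 : Primrec fun x : (List Bool × List Bool) × ((List Bool × List Bool) ×
        List (List Bool)) => x.2.2 := Primrec.snd.comp Primrec.snd
    refine rePred_exists (p := r) (rePred_and (rePred_of_primrecPred ?_) (rePred_and ?_
      (rePred_of_primrecPred ?_)))
    · exact (Primrec.eq.comp (Primrec.fst.comp Primrec.fst) (Primrec.list_append.comp h1 h2)).and
        (Primrec.eq.comp (Primrec.list_length.comp h1) (Primrec.list_length.comp h2))
    · exact rePred_comp (p := fun x : (ℕ × List Bool) × List (List Bool) =>
          ListsModel enc 𝒜 x.1.1 x.1.2 x.2) (rePred_listsModel henc h𝒜)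
        (g := fun x : (List Bool × List Bool) × ((List Bool × List Bool) × List (List Bool)) =>
          ((x.2.1.1.length, x.1.2), x.2.2))
        (((Primrec.list_length.comp h1).pair (Primrec.snd.comp Primrec.fst)).pair h3).to_comp
    · exact (primrecRel_mem.comp h1 h3).and (primrecRel_mem.comp h2 h3)
  obtain ⟨W, hW, hW1, hW2⟩ := exists_partrec_selector (p := fun q z => ∃ w, r (q, z) w) hr
  obtain ⟨c, hc⟩ := complexity_le_of_partrec hV hW
  refine ⟨c, fun n A hA x hx y hy => ?_⟩
  have hxl := (mem_slice.1 hA).2 x hx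
  have hyl := (mem_slice.1 hA).2 y hy
  -- Equal lengths let `x ++ y` be split at its midpoint, so no delimiter is paid for. The search
  -- may return a common model other than `A`.
  obtain ⟨z, hz⟩ := hW2 (x ++ y) (enc A) ⟨((x, y), A.toList), ⟨rfl, hxl.trans hyl.symm⟩,
    by simpa [hxl] using listsModel_toList enc hA, by simpa using hx, by simpa using hy⟩
  obtain ⟨⟨⟨x', y'⟩, L⟩, ⟨hxy, hl⟩, hL, hxL, hyL⟩ := hW1 _ _ hz
  simp only at hxy hl hL hxL hyL
  have hlen := congrArg List.length hxy
  simp only [List.length_append] at hlen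
  obtain ⟨rfl, rfl⟩ := List.append_inj hxy (by omega)
  refine ⟨L.toFinset, hxl ▸ hL.mem_slice, by simpa using hxL, by simpa using hyL, ?_⟩
  rw [← hL.1]
  have := hc _ _ hz
  rw [List.length_append] at this
  omega

/-! ### Online covering

Finite sets, each given by a key and a list of points, arrive one by one. Some of them are marked on
arrival, so that a point in many sets is in some marked set, while few sets are marked. -/

section Cover

variable {κ β : Type*} [DecidableEq β]

/-- The number of sets in `s` that contain `u`. -/
def hits (s : List (κ × List β)) (u : β) : ℕ :=
  (s.map fun B => if u ∈ B.2 then 1 else 0).sum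

/-- The scaled weight `Q ^ |s| (1 + 1 / Q) ^ hits` of a point that is in no marked set, and `0`
for other points. -/
def weight (Q : ℕ) (s M : List (κ × List β)) (u : β) : ℕ :=
  if ∃ B ∈ M, u ∈ B.2 then 0 else (Q + 1) ^ hits s u * Q ^ (s.length - hits s u)

/-- The sets marked among the sets of the list `s`, whose head is the last set to arrive: a set is
marked if the total weight of its points is at least `θ`. -/
def marks (Q θ : ℕ) : List (κ × List β) → List (κ × List β)
  | [] => []
  | A :: s => if θ * Q ^ s.length ≤ (A.2.map (weight Q s (marks Q θ s))).sum
      then A :: marks Q θ s else marks Q θ s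

theorem hits_cons (A : κ × List β) (s : List (κ × List β)) (u : β) :
    hits (A :: s) u = (if u ∈ A.2 then 1 else 0) + hits s u := by
  simp [hits]

theorem hits_le_length (s : List (κ × List β)) (u : β) : hits s u ≤ s.length := by
  induction s with
  | nil => simp [hits]
  | cons A s ih =>
    rw [hits_cons, List.length_cons]
    split_ifs <;> omega

/-- Decisions are never revised, so the position of a marked set, counted from the oldest, is final
and can serve as a description. -/
theorem marks_suffix (Q θ : ℕ) {s s' : List (κ × List β)} (h : s <:+ s') :
    marks Q θ s <:+ marks Q θ s' := by
  induction s' with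
  | nil => rw [List.suffix_nil.1 h]
  | cons A s' ih =>
    rcases List.suffix_cons_iff.1 h with h | h
    · rw [h]
    · refine (ih h).trans ?_
      rw [marks]
      split_ifs
      · exact List.suffix_cons _ _
      · exact List.suffix_rfl

theorem marks_subset (Q θ : ℕ) (s : List (κ × List β)) : marks Q θ s ⊆ s := by
  induction s with
  | nil => simp [marks]
  | cons A s ih =>
    rw [marks]
    split_ifs
    · exact List.cons_subset_cons _ ih
    · exact List.Subset.trans ih (List.subset_cons_self _ _)

/-- The weight of a point as a real number, without the scaling. -/
noncomputable def realWeight (Q : ℕ) (s M : List (κ × List β)) (u : β) : ℝ :=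
  if ∃ B ∈ M, u ∈ B.2 then 0 else (1 + 1 / (Q : ℝ)) ^ hits s u

/-- The scaled weights are natural numbers so that the marking rule is primitive recursive; this
passes to real weights for the analysis. -/
theorem weight_eq {Q : ℕ} (hQ : 0 < Q) (s M : List (κ × List β)) (u : β) :
    (weight Q s M u : ℝ) = (Q : ℝ) ^ s.length * realWeight Q s M u := by
  unfold weight realWeight
  split_ifs
  · simp
  · have hQ' : (Q : ℝ) ≠ 0 := by positivity
    have h1 : (Q : ℝ) ^ s.length = Q ^ hits s u * Q ^ (s.length - hits s u) := by
      rw [← pow_add, Nat.add_sub_cancel' (hits_le_length s u)]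
    have h2 : (Q : ℝ) * (1 + 1 / Q) = Q + 1 := by field_simp
    rw [h1, mul_right_comm, ← mul_pow, h2]
    push_cast
    ring

theorem sum_weight_eq {Q : ℕ} (hQ : 0 < Q) (s M : List (κ × List β)) {P : List β}
    (hP : P.Nodup) : (((P.map (weight Q s M)).sum : ℕ) : ℝ) =
      (Q : ℝ) ^ s.length * ∑ u ∈ P.toFinset, realWeight Q s M u := by
  rw [← List.sum_toFinset _ hP]
  push_cast
  rw [Finset.mul_sum]
  exact Finset.sum_congr rfl fun u _ => weight_eq hQ s M u

/-- The potential bound behind the marking rule. -/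
theorem sum_realWeight_add_le {Q θ : ℕ} (hQ : 0 < Q) {U : Finset β} (hU : U.card ≤ θ)
    (s : List (κ × List β)) (hs : ∀ B ∈ s, B.2.Nodup ∧ ∀ u ∈ B.2, u ∈ U) :
    ∑ u ∈ U, realWeight Q s (marks Q θ s) u + θ * (marks Q θ s).length ≤
      θ + θ * s.length / (Q : ℝ) := by
  have hQ' : (0 : ℝ) < Q := by exact_mod_cast hQ
  induction s with
  | nil =>
    simp only [marks, realWeight, hits, List.not_mem_nil, false_and, exists_false, if_false,
      List.map_nil, List.sum_nil, pow_zero, Finset.sum_const, nsmul_eq_mul, mul_one,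
      List.length_nil, Nat.cast_zero, mul_zero, add_zero, zero_div]
    exact_mod_cast hU
  | cons A s ih =>
    have ih := ih fun B hB => hs B (List.mem_cons_of_mem _ hB)
    obtain ⟨hnd, hAU⟩ := hs A List.mem_cons_self
    have hsub : A.2.toFinset ⊆ U := fun u hu => hAU u (List.mem_toFinset.1 hu)
    have hsplit := fun f : β → ℝ => (Finset.sum_sdiff (f := f) hsub).symm
    set M := marks Q θ s with hM
    have hsum := sum_weight_eq hQ s M hnd
    have hout : ∀ M' : List (κ × List β), (M' = M ∨ M' = A :: M) →
        ∑ u ∈ U \ A.2.toFinset, realWeight Q (A :: s) M' u =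
          ∑ u ∈ U \ A.2.toFinset, realWeight Q s M u := by
      intro M' hM'
      refine Finset.sum_congr rfl fun u hu => ?_
      have hu' : u ∉ A.2 := fun h => (Finset.mem_sdiff.1 hu).2 (List.mem_toFinset.2 h)
      have hc : (∃ B ∈ M', u ∈ B.2) ↔ ∃ B ∈ M, u ∈ B.2 := by
        rcases hM' with rfl | rfl
        · rfl
        · simp [hu']
      simp only [realWeight, hits_cons, hc, hu', if_false, zero_add]
    have hlen : (θ : ℝ) * ((A :: s).length : ℕ) / Q = θ * s.length / Q + θ / Q := by
      rw [List.length_cons]; push_cast; ring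
    have hpow : (0 : ℝ) < (Q : ℝ) ^ s.length := by positivity
    rw [hlen, marks, ← hM]
    split_ifs with h
    -- Marked: the points of `A` lose weight at least `θ`, which pays for the additional mark.
    · have h1 : (θ : ℝ) ≤ ∑ u ∈ A.2.toFinset, realWeight Q s M u := by
        have h' : ((θ * Q ^ s.length : ℕ) : ℝ) ≤ ((A.2.map (weight Q s M)).sum : ℕ) := by
          exact_mod_cast h
        rw [hsum] at h'
        push_cast at h'
        rw [mul_comm] at h'
        exact le_of_mul_le_mul_left h' hpow
      have h2 : ∑ u ∈ A.2.toFinset, realWeight Q (A :: s) (A :: M) u = 0 := by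
        refine Finset.sum_eq_zero fun u hu => ?_
        rw [realWeight, if_pos ⟨A, List.mem_cons_self, List.mem_toFinset.1 hu⟩]
      have h3 : (0 : ℝ) ≤ θ / Q := by positivity
      rw [hsplit] at ih ⊢
      rw [h2, hout _ (Or.inr rfl), List.length_cons]
      push_cast
      linarith
    -- Not marked: the weight inside `A` is at most `θ` and is multiplied by 1 + 1/Q, so the
    -- potential grows by at most `θ / Q`.
    · have h1 : ∑ u ∈ A.2.toFinset, realWeight Q s M u ≤ θ := by
        have h' : (((A.2.map (weight Q s M)).sum : ℕ) : ℝ) ≤ ((θ * Q ^ s.length : ℕ) : ℝ) := by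
          exact_mod_cast (not_le.1 h).le
        rw [hsum] at h'
        push_cast at h'
        rw [mul_comm (θ : ℝ)] at h'
        exact le_of_mul_le_mul_left h' hpow
      have h2 : ∑ u ∈ A.2.toFinset, realWeight Q (A :: s) M u =
          (1 + 1 / Q) * ∑ u ∈ A.2.toFinset, realWeight Q s M u := by
        rw [Finset.mul_sum]
        refine Finset.sum_congr rfl fun u hu => ?_
        simp only [realWeight, hits_cons, if_pos (List.mem_toFinset.1 hu)]
        split_ifs
        · simp
        · rw [pow_add, pow_one]
      rw [hsplit] at ih ⊢
      rw [h2, hout _ (Or.inl rfl)]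
      have h3 : 1 / (Q : ℝ) * ∑ u ∈ A.2.toFinset, realWeight Q s M u ≤ θ / Q := by
        rw [div_mul_eq_mul_div, one_mul]
        gcongr
      linarith

theorem realWeight_nonneg (Q : ℕ) (s M : List (κ × List β)) (u : β) :
    0 ≤ realWeight Q s M u := by
  unfold realWeight
  split_ifs <;> positivity

/-- The weights in the potential bound are nonnegative and can be dropped. -/
theorem length_marks_mul_le {Q θ : ℕ} (hQ : 0 < Q) (hθ : 0 < θ) {U : Finset β}
    (hU : U.card ≤ θ) (s : List (κ × List β)) (hs : ∀ B ∈ s, B.2.Nodup ∧ ∀ u ∈ B.2, u ∈ U) :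
    (marks Q θ s).length * Q ≤ Q + s.length := by
  have h := sum_realWeight_add_le hQ hU s hs
  have hQ' : (0 : ℝ) < Q := by exact_mod_cast hQ
  have hθ' : (0 : ℝ) < θ := by exact_mod_cast hθ
  have h0 : 0 ≤ ∑ u ∈ U, realWeight Q s (marks Q θ s) u :=
    Finset.sum_nonneg fun u _ => realWeight_nonneg _ _ _ _
  have h1 : (θ : ℝ) * ((marks Q θ s).length * Q) ≤ θ * (Q + s.length) := by
    have h2 : (θ : ℝ) * (marks Q θ s).length ≤ θ + θ * s.length / (Q : ℝ) := by linarith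
    have h3 := mul_le_mul_of_nonneg_right h2 hQ'.le
    have h4 : ((θ : ℝ) + θ * s.length / (Q : ℝ)) * Q = θ * (Q + s.length) := by
      field_simp
    linarith
  exact_mod_cast le_of_mul_le_mul_left h1 hθ'

/-- By Bernoulli, an uncovered point with Q D hits has weight at least (1 + 1/Q)^(QD) ≥ 2^D, which
alone exceeds the potential bound. -/
theorem exists_mem_marks {Q θ D : ℕ} (hQ : 0 < Q) {U : Finset β} (hU : U.card ≤ θ)
    (s : List (κ × List β)) (hs : ∀ B ∈ s, B.2.Nodup ∧ ∀ u ∈ B.2, u ∈ U)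
    (hD : θ * (Q + s.length) < Q * 2 ^ D) {u : β} (hu : u ∈ U) (hits_u : Q * D ≤ hits s u) :
    ∃ B ∈ marks Q θ s, u ∈ B.2 := by
  by_contra hcon
  have h := sum_realWeight_add_le hQ hU s hs
  have hQ' : (0 : ℝ) < Q := by exact_mod_cast hQ
  have h1 := Finset.single_le_sum (f := realWeight Q s (marks Q θ s))
    (fun u _ => realWeight_nonneg _ _ _ _) hu
  have h2 : (2 : ℝ) ^ D ≤ realWeight Q s (marks Q θ s) u := by
    rw [realWeight, if_neg hcon]
    have h3 : (2 : ℝ) ≤ (1 + 1 / (Q : ℝ)) ^ Q := by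
      have h4 := one_add_mul_le_pow (a := 1 / (Q : ℝ)) (by
        have : 0 ≤ 1 / (Q : ℝ) := by positivity
        linarith) Q
      have h5 : (Q : ℝ) * (1 / Q) = 1 := by field_simp
      linarith
    calc (2 : ℝ) ^ D ≤ ((1 + 1 / (Q : ℝ)) ^ Q) ^ D := by gcongr
      _ = (1 + 1 / (Q : ℝ)) ^ (Q * D) := by rw [pow_mul]
      _ ≤ _ := pow_le_pow_right₀ (by
        have : 0 ≤ 1 / (Q : ℝ) := by positivity
        linarith) hits_u
  have h3 : (0 : ℝ) ≤ θ * (marks Q θ s).length := by positivity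
  have h4 : (2 : ℝ) ^ D ≤ θ + θ * s.length / (Q : ℝ) := by linarith
  have h5 := mul_le_mul_of_nonneg_left h4 hQ'.le
  have h6 : (Q : ℝ) * (θ + θ * s.length / (Q : ℝ)) = θ * (Q + s.length) := by
    field_simp
  rw [h6] at h5
  have h7 : ((θ * (Q + s.length) : ℕ) : ℝ) < ((Q * 2 ^ D : ℕ) : ℝ) := by exact_mod_cast hD
  push_cast at h7
  linarith

theorem hits_eq_length_filter (s : List (κ × List β)) (u : β) :
    hits s u = (s.filter fun B => u ∈ B.2).length := by
  induction s with
  | nil => simp [hits]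
  | cons A s ih =>
    rw [hits_cons, List.filter_cons, ih]
    by_cases h : u ∈ A.2 <;> simp [h, add_comm]

theorem card_le_hits [DecidableEq κ] {s : List (κ × List β)} {u : β} {K : Finset κ}
    (hK : ∀ k ∈ K, ∃ B ∈ s, B.1 = k ∧ u ∈ B.2) : K.card ≤ hits s u := by
  rw [hits_eq_length_filter, ← List.length_map (f := Prod.fst)]
  refine (Finset.card_le_card fun k hk => ?_).trans (List.toFinset_card_le _)
  obtain ⟨B, hB, hBk, hu⟩ := hK k hk
  exact List.mem_toFinset.2 (List.mem_map.2 ⟨B, List.mem_filter.2 ⟨hB, by simpa using hu⟩, hBk⟩)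

end Cover

section Arrival

variable {κ β : Type*} [DecidableEq κ]

/-! ### The sequence of arriving sets -/

/-- `A` is added to the sequence `s` of arrived sets, unless there is a set with the same key. -/
def push (s : List (κ × List β)) (A : κ × List β) : List (κ × List β) :=
  if ∃ B ∈ s, B.1 = A.1 then s else A :: s

/-- The sets that `h` enumerates before the moment `t`, without repetitions of keys. -/
def arrived (h : ℕ → Option (κ × List β)) : ℕ → List (κ × List β)
  | 0 => []
  | t + 1 => (h t).elim (arrived h t) (push (arrived h t))

theorem arrived_suffix (h : ℕ → Option (κ × List β)) {t t' : ℕ} (ht : t ≤ t') :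
    arrived h t <:+ arrived h t' := by
  induction ht with
  | refl => exact List.suffix_rfl
  | step _ ih =>
    refine ih.trans ?_
    rw [arrived]
    cases h _ with
    | none => exact List.suffix_rfl
    | some A =>
      simp only [Option.elim, push]
      split_ifs
      · exact List.suffix_rfl
      · exact List.suffix_cons _ _

theorem exists_of_mem_arrived {h : ℕ → Option (κ × List β)} {t : ℕ} {A : κ × List β}
    (hA : A ∈ arrived h t) : ∃ i, h i = some A := by
  induction t with
  | zero => simp [arrived] at hA
  | succ t ih =>
    rw [arrived] at hA
    cases ht : h t with
    | none => exact ih (by simpa [ht] using hA)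
    | some B =>
      simp only [ht, Option.elim, push] at hA
      split_ifs at hA
      · exact ih hA
      · rcases List.mem_cons.1 hA with rfl | hA
        · exact ⟨t, ht⟩
        · exact ih hA

theorem exists_mem_arrived {h : ℕ → Option (κ × List β)} {t : ℕ} {A : κ × List β}
    (hA : h t = some A) : ∃ B ∈ arrived h (t + 1), B.1 = A.1 := by
  rw [arrived, hA]
  simp only [Option.elim, push]
  split_ifs with h
  · exact h
  · exact ⟨A, List.mem_cons_self, rfl⟩

theorem nodup_arrived (h : ℕ → Option (κ × List β)) (t : ℕ) :
    ((arrived h t).map Prod.fst).Nodup := by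
  induction t with
  | zero => simp [arrived]
  | succ t ih =>
    rw [arrived]
    cases h t with
    | none => exact ih
    | some A =>
      simp only [Option.elim, push]
      split_ifs with hA
      · exact ih
      · rw [List.map_cons, List.nodup_cons]
        refine ⟨fun hmem => hA ?_, ih⟩
        obtain ⟨B, hB, hBA⟩ := List.mem_map.1 hmem
        exact ⟨B, hB, hBA⟩

end Arrival

/-! ### Computability of the marking procedure -/

section CoverComputability

variable {κ β : Type*} [Primcodable κ] [Primcodable β]

theorem primrec_list_sum : Primrec fun l : List ℕ => l.sum :=
  Primrec.list_foldr (f := fun l : List ℕ => l) (g := fun _ => 0) (h := fun _ x => x.1 + x.2)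
    Primrec.id (Primrec.const 0)
    (Primrec.nat_add.comp (Primrec.fst.comp Primrec.snd) (Primrec.snd.comp Primrec.snd))

theorem primrec₂_hits [DecidableEq β] : Primrec₂ fun (s : List (κ × List β)) (u : β) => hits s u := by
  refine primrec_list_sum.comp (Primrec.list_map Primrec.fst ?_)
  exact Primrec.ite (primrecRel_mem.comp (Primrec.snd.comp Primrec.fst)
    (Primrec.snd.comp Primrec.snd)) (Primrec.const 1) (Primrec.const 0)

theorem primrec_weight [DecidableEq β] :
    Primrec fun x : (ℕ × List (κ × List β) × List (κ × List β)) × β =>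
      weight x.1.1 x.1.2.1 x.1.2.2 x.2 := by
  have hQ : Primrec fun x : (ℕ × List (κ × List β) × List (κ × List β)) × β => x.1.1 :=
    Primrec.fst.comp Primrec.fst
  have hs : Primrec fun x : (ℕ × List (κ × List β) × List (κ × List β)) × β => x.1.2.1 :=
    Primrec.fst.comp (Primrec.snd.comp Primrec.fst)
  have hM : Primrec fun x : (ℕ × List (κ × List β) × List (κ × List β)) × β => x.1.2.2 :=
    Primrec.snd.comp (Primrec.snd.comp Primrec.fst)
  have hh := primrec₂_hits.comp hs Primrec.snd
  have hr : PrimrecRel fun (B : κ × List β) (u : β) => u ∈ B.2 :=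
    primrecRel_mem.comp Primrec.snd (Primrec.snd.comp Primrec.fst)
  refine Primrec.ite (hr.exists_mem_list.comp hM Primrec.snd) (Primrec.const 0) ?_
  exact Primrec.nat_mul.comp (primrec₂_pow.comp (Primrec.succ.comp hQ) hh)
    (primrec₂_pow.comp hQ (Primrec.nat_sub.comp (Primrec.list_length.comp hs) hh))

theorem primrec_marks [DecidableEq β] :
    Primrec fun x : (ℕ × ℕ) × List (κ × List β) => marks x.1.1 x.1.2 x.2 := by
  have hQ : Primrec fun x : ((ℕ × ℕ) × List (κ × List β)) × ((κ × List β) ×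
      List (κ × List β) × List (κ × List β)) => x.1.1.1 :=
    Primrec.fst.comp (Primrec.fst.comp Primrec.fst)
  have hθ : Primrec fun x : ((ℕ × ℕ) × List (κ × List β)) × ((κ × List β) ×
      List (κ × List β) × List (κ × List β)) => x.1.1.2 :=
    Primrec.snd.comp (Primrec.fst.comp Primrec.fst)
  have hA : Primrec fun x : ((ℕ × ℕ) × List (κ × List β)) × ((κ × List β) ×
      List (κ × List β) × List (κ × List β)) => x.2.1 := Primrec.fst.comp Primrec.snd
  have hs : Primrec fun x : ((ℕ × ℕ) × List (κ × List β)) × ((κ × List β) ×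
      List (κ × List β) × List (κ × List β)) => x.2.2.1 :=
    Primrec.fst.comp (Primrec.snd.comp Primrec.snd)
  have hM : Primrec fun x : ((ℕ × ℕ) × List (κ × List β)) × ((κ × List β) ×
      List (κ × List β) × List (κ × List β)) => x.2.2.2 :=
    Primrec.snd.comp (Primrec.snd.comp Primrec.snd)
  have hsum : Primrec fun x : ((ℕ × ℕ) × List (κ × List β)) × ((κ × List β) ×
      List (κ × List β) × List (κ × List β)) =>
      (x.2.1.2.map (weight x.1.1.1 x.2.2.1 x.2.2.2)).sum := by
    refine primrec_list_sum.comp (Primrec.list_map (Primrec.snd.comp hA) ?_)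
    exact primrec_weight.comp (((hQ.comp Primrec.fst).pair
      ((hs.comp Primrec.fst).pair (hM.comp Primrec.fst))).pair Primrec.snd)
  refine (Primrec.list_rec (f := fun x : (ℕ × ℕ) × List (κ × List β) => x.2)
    (g := fun _ => ([] : List (κ × List β)))
    (h := fun x y => if x.1.2 * x.1.1 ^ y.2.1.length ≤
      (y.1.2.map (weight x.1.1 y.2.1 y.2.2)).sum then y.1 :: y.2.2 else y.2.2)
    Primrec.snd (Primrec.const []) ?_).of_eq fun x => ?_
  · exact Primrec.ite (Primrec.nat_le.comp (Primrec.nat_mul.comp hθ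
      (primrec₂_pow.comp hQ (Primrec.list_length.comp hs))) hsum)
      (Primrec.list_cons.comp hA hM) hM
  · rcases x with ⟨⟨Q, θ⟩, l⟩
    induction l with
    | nil => rfl
    | cons A s ih =>
      simp only at ih
      simp only [marks, ih]

theorem primrec₂_push [DecidableEq κ] : Primrec₂ fun (s : List (κ × List β)) (A : κ × List β) => push s A := by
  have hr : PrimrecRel fun (B A : κ × List β) => B.1 = A.1 :=
    Primrec.eq.comp (Primrec.fst.comp Primrec.fst) (Primrec.fst.comp Primrec.snd)
  exact Primrec.ite (hr.exists_mem_list.comp Primrec.fst Primrec.snd) Primrec.fst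
    (Primrec.list_cons.comp Primrec.snd Primrec.fst)

theorem primrec₂_arrived [DecidableEq κ] {π : Type*} [Primcodable π] {h : π → ℕ → Option (κ × List β)}
    (hh : Primrec₂ h) : Primrec₂ fun a t => arrived (h a) t := by
  refine (Primrec.nat_rec (f := fun _ : π => ([] : List (κ × List β)))
    (g := fun a x => (h a x.1).elim x.2 (push x.2)) (Primrec.const []) ?_).of_eq fun a t => ?_
  · have h1 : Primrec fun x : π × (ℕ × List (κ × List β)) => h x.1 x.2.1 :=
      hh.comp Primrec.fst (Primrec.fst.comp Primrec.snd)
    refine (Primrec.option_casesOn h1 (Primrec.snd.comp Primrec.snd)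
      (g := fun x A => push x.2.2 A) (primrec₂_push.comp
        (Primrec.snd.comp (Primrec.snd.comp Primrec.fst)) Primrec.snd)).of_eq fun x => ?_
    show _ = (h x.1 x.2.1).elim x.2.2 (push x.2.2)
    cases h x.1 x.2.1 <;> rfl
  · induction t with
    | zero => rfl
    | succ t ih => simp only [arrived, ih]

end CoverComputability

/-! ### From covering to complexity -/

/-- The covering lemma: a point that belongs to many sets of an enumerable family belongs to a set
of small complexity. The complexity is that of the first component of the key. -/
theorem exists_cover_complexity_le {V : List Bool →. List Bool} (hV : IsOptimalDecompressor V)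
    {β : Type*} [DecidableEq β] [Primcodable β]
    {R : ℕ → (List Bool × ℕ) × List β → Prop}
    (hR : REPred fun x : ℕ × ((List Bool × ℕ) × List β) => R x.1 x.2)
    {Q θ : ℕ → ℕ} (hQ : Primrec Q) (hθ : Primrec θ) :
    ∃ c : ℕ, ∀ a, 0 < Q a → 0 < θ a → ∀ (U : Finset β) (N D : ℕ), U.card ≤ θ a →
      (∀ A, R a A → A.2.Nodup ∧ ∀ u ∈ A.2, u ∈ U) →
      (∀ A B, R a A → R a B → A.1 = B.1 → ∀ u ∈ A.2, u ∈ B.2) →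
      (∀ K : Finset (List Bool × ℕ), (∀ k ∈ K, ∃ P, R a (k, P)) → K.card ≤ N) →
      θ a * (Q a + N) < Q a * 2 ^ D →
      ∀ (u : β) (K : Finset (List Bool × ℕ)), u ∈ U → (∀ k ∈ K, ∃ P, R a (k, P) ∧ u ∈ P) →
      Q a * D ≤ K.card →
      ∃ k P b, R a (k, P) ∧ u ∈ P ∧ b * Q a ≤ N ∧
        complexity V k.1 ≤ 2 * a.size + b.size + c := by
  obtain ⟨h, hh, hRh⟩ := exists_primrec_enum hR
  -- New marks are put at the head of the list; reversal lists the oldest first, which makes the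
  -- index stable in `t`.
  let f : ℕ × ℕ → ℕ → Option (List Bool) := fun x t =>
    ((marks (Q x.1) (θ x.1) (arrived (h x.1) t)).reverse[x.2]?).map fun B => B.1.1
  have hf : Primrec₂ f := by
    have h1 : Primrec fun x : (ℕ × ℕ) × ℕ => x.1.1 := Primrec.fst.comp Primrec.fst
    refine Primrec.option_map (Primrec.list_getElem?.comp (Primrec.list_reverse.comp
      (primrec_marks.comp (((hQ.comp h1).pair (hθ.comp h1)).pair
        ((primrec₂_arrived hh).comp h1 Primrec.snd)))) (Primrec.snd.comp Primrec.fst)) ?_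
    exact Primrec.fst.comp (Primrec.fst.comp Primrec.snd)
  have hmono : ∀ x t t' z, t ≤ t' → f x t = some z → f x t' = some z := by
    intro x t t' z ht hz
    obtain ⟨B, hB, hBz⟩ := Option.map_eq_some_iff.1 hz
    obtain ⟨l, hl⟩ := marks_suffix (Q x.1) (θ x.1) (arrived_suffix (h x.1) ht)
    refine Option.map_eq_some_iff.2 ⟨B, ?_, hBz⟩
    rw [← hl, List.reverse_append]
    obtain ⟨hlt, -⟩ := List.getElem?_eq_some_iff.1 hB
    rw [List.getElem?_append_left hlt, hB]
  obtain ⟨c, hc⟩ := complexity_le_of_rePred hV (p := fun x z => ∃ t, f x t = some z)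
    (rePred_exists (p := fun (x : (ℕ × ℕ) × List Bool) (t : ℕ) => f x.1 t = some x.2)
      (rePred_eq (hf.comp (Primrec.fst.comp Primrec.fst) Primrec.snd).to_comp
        (Primrec.option_some.comp (Primrec.snd.comp Primrec.fst)).to_comp))
    (by
      rintro a z z' ⟨t, ht⟩ ⟨t', ht'⟩
      have h1 := hmono _ _ _ _ (le_max_left t t') ht
      have h2 := hmono _ _ _ _ (le_max_right t t') ht'
      exact Option.some.inj (h1.symm.trans h2))
  refine ⟨c, fun a hQa hθa U N D hU hpts hkey hN hD u K hu hK hKD => ?_⟩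
  -- A moment by which every key of the finite set `K` has arrived.
  obtain ⟨T, hT⟩ : ∃ T, ∀ k ∈ K, ∃ B ∈ arrived (h a) T, B.1 = k := by
    have h1 : ∀ k : List Bool × ℕ, ∃ t, k ∈ K → ∃ B ∈ arrived (h a) t, B.1 = k := by
      intro k
      by_cases hk : k ∈ K
      · obtain ⟨P, hP, -⟩ := hK k hk
        obtain ⟨t, ht⟩ := (hRh _ _).1 hP
        exact ⟨t + 1, fun _ => exists_mem_arrived ht⟩
      · exact ⟨0, fun h => absurd h hk⟩
    choose t ht using h1
    refine ⟨K.sup t, fun k hk => ?_⟩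
    obtain ⟨B, hB, hBk⟩ := ht k hk
    exact ⟨B, (arrived_suffix (h a) (Finset.le_sup hk)).subset hB, hBk⟩
  set s := arrived (h a) T with hs
  have hsR : ∀ B ∈ s, R a B := fun B hB => (hRh a B).2 (exists_of_mem_arrived hB)
  have hs' : ∀ B ∈ s, B.2.Nodup ∧ ∀ u ∈ B.2, u ∈ U := fun B hB => hpts B (hsR B hB)
  have hslen : s.length ≤ N := by
    have h1 := hN (s.map Prod.fst).toFinset (by
      intro k hk
      obtain ⟨B, hB, rfl⟩ := List.mem_map.1 (List.mem_toFinset.1 hk)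
      exact ⟨B.2, hsR B hB⟩)
    rwa [List.toFinset_card_of_nodup (nodup_arrived _ _), List.length_map] at h1
  have hhits : Q a * D ≤ hits s u := by
    refine hKD.trans (card_le_hits fun k hk => ?_)
    obtain ⟨B, hB, hBk⟩ := hT k hk
    obtain ⟨P, hP, huP⟩ := hK k hk
    -- The list that arrived under a key may differ from `P`, but has the same points.
    exact ⟨B, hB, hBk, hkey _ _ hP (hsR B hB) hBk.symm u huP⟩
  have hD' : θ a * (Q a + s.length) < Q a * 2 ^ D :=
    lt_of_le_of_lt (by gcongr) hD
  obtain ⟨B, hB, huB⟩ := exists_mem_marks hQa hU s hs' hD' hu hhits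
  have hlen := length_marks_mul_le hQa hθa hU s hs'
  obtain ⟨b, hb, hbB⟩ := List.getElem_of_mem (List.mem_reverse.2 hB)
  refine ⟨B.1, B.2, b, hsR B (marks_subset _ _ _ hB), huB, ?_, hc a b B.1.1 ⟨T, ?_⟩⟩
  · rw [List.length_reverse] at hb
    -- Positions start at 0, so b + 1 marks exist; the extra one cancels the summand `Q` in the
    -- bound on the number of marks.
    have h2 : (b + 1) * Q a ≤ (marks (Q a) (θ a) s).length * Q a := by gcongr; exact hb
    rw [add_mul, one_mul] at h2
    omega
  · show Option.map _ _ = _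
    rw [List.getElem?_eq_getElem hb, hbB]
    rfl

/-! ### Models that contain a pair of strings -/

theorem primrecPred_nodup {α : Type*} [Primcodable α] : PrimrecPred fun L : List α => L.Nodup := by
  classical
  have h1 : PrimrecRel fun (a : α) (L : List α) => (L.filter fun b => b = a).length ≤ 1 :=
    Primrec.nat_le.comp (Primrec.list_length.comp
      ((Primrec.eq (α := α)).listFilter.comp Primrec.snd Primrec.fst)) (Primrec.const 1)
  refine (h1.forall_mem_list.comp Primrec.id Primrec.id).of_eq fun L => ?_
  simp only [id, List.nodup_iff_count_le_one, List.count_eq_length_filter]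
  constructor
  · intro h a
    by_cases ha : a ∈ L
    · simpa only [beq_eq_decide] using h a ha
    · rw [← List.count_eq_length_filter, List.count_eq_zero_of_not_mem ha]
      exact Nat.zero_le _
  · intro h a _
    simpa only [beq_eq_decide] using h a

/-- The relation that is enumerated in the covering argument. The parameter `a` encodes `n`, `l`
and a third number. A set with code `z` is enumerated with several keys `(z, j)`, whose number is
proportional to `m z`, and its points are the pairs of its elements. -/
def ModelItem (m : List Bool → ℝ) (enc : Finset (List Bool) → List Bool)
    (𝒜 : Set (Finset (List Bool))) (a : ℕ)
    (B : (List Bool × ℕ) × List (List Bool × List Bool)) : Prop :=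
  ((B.1.2 + 1 : ℕ) : ℝ) / (((2 ^ (10 * a.unpair.1) - 1 : ℕ) : ℝ) + 1) < m B.1.1 ∧
    ∃ L : List (List Bool), ListsModel enc 𝒜 a.unpair.1 B.1.1 L ∧
      L.Nodup ∧ L.length ≤ 2 ^ (a.unpair.2.unpair.1 + 1) ∧
      B.2 = L.flatMap fun x => L.map fun y => (x, y)

theorem rePred_modelItem {m : List Bool → ℝ} (hm : IsLowerSemicomputableSemimeasure m)
    {enc : Finset (List Bool) → List Bool} (henc : IsComputableEncoding enc)
    {𝒜 : Set (Finset (List Bool))} (h𝒜 : IsDecidableFamily 𝒜) :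
    REPred fun x : ℕ × ((List Bool × ℕ) × List (List Bool × List Bool)) =>
      ModelItem m enc 𝒜 x.1 x.2 := by
  have hn : Primrec fun a : ℕ => a.unpair.1 := Primrec.fst.comp Primrec.unpair
  have hl : Primrec fun a : ℕ => a.unpair.2.unpair.1 :=
    Primrec.fst.comp (Primrec.unpair.comp (Primrec.snd.comp Primrec.unpair))
  refine rePred_and ?_ (rePred_exists (p := fun (x : ℕ × ((List Bool × ℕ) ×
      List (List Bool × List Bool))) (L : List (List Bool)) =>
      ListsModel enc 𝒜 x.1.unpair.1 x.2.1.1 L ∧ L.Nodup ∧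
      L.length ≤ 2 ^ (x.1.unpair.2.unpair.1 + 1) ∧
      x.2.2 = L.flatMap fun x => L.map fun y => (x, y))
    (rePred_and ?_ (rePred_and ?_ (rePred_and ?_ ?_))))
  · refine rePred_comp (p := fun t : (ℕ × ℕ) × List Bool =>
      (t.1.1 : ℝ) / ((t.1.2 : ℝ) + 1) < m t.2) hm.2.2.2
      (g := fun x : ℕ × ((List Bool × ℕ) × List (List Bool × List Bool)) =>
        ((x.2.1.2 + 1, 2 ^ (10 * x.1.unpair.1) - 1), x.2.1.1)) (Primrec.to_comp ?_)
    refine Primrec.pair (Primrec.pair ?_ ?_) ?_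
    · exact Primrec.succ.comp (Primrec.snd.comp (Primrec.fst.comp Primrec.snd))
    · exact Primrec.pred.comp (primrec₂_pow.comp (Primrec.const 2)
        (Primrec.nat_mul.comp (Primrec.const 10) (hn.comp Primrec.fst)))
    · exact Primrec.fst.comp (Primrec.fst.comp Primrec.snd)
  · refine rePred_comp (p := fun x : (ℕ × List Bool) × List (List Bool) =>
        ListsModel enc 𝒜 x.1.1 x.1.2 x.2) (rePred_listsModel henc h𝒜)
      (g := fun x : (ℕ × ((List Bool × ℕ) × List (List Bool × List Bool))) ×
        List (List Bool) => ((x.1.1.unpair.1, x.1.2.1.1), x.2)) (Primrec.to_comp ?_)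
    exact ((hn.comp (Primrec.fst.comp Primrec.fst)).pair
      (Primrec.fst.comp (Primrec.fst.comp (Primrec.snd.comp Primrec.fst)))).pair Primrec.snd
  · exact rePred_of_primrecPred (primrecPred_nodup.comp Primrec.snd)
  · exact rePred_of_primrecPred (Primrec.nat_le.comp (Primrec.list_length.comp Primrec.snd)
      (primrec₂_pow.comp (Primrec.const 2)
        (Primrec.succ.comp (hl.comp (Primrec.fst.comp Primrec.fst)))))
  · refine rePred_eq (Computable.snd.comp (Computable.snd.comp Computable.fst))
      (Primrec.to_comp ?_)
    refine Primrec.list_flatMap Primrec.snd ?_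
    refine Primrec.list_map (Primrec.snd.comp Primrec.fst) ?_
    exact Primrec.pair (Primrec.snd.comp Primrec.fst) Primrec.snd

/-- A string z occurs in at most N m(z) keys, and m sums to at most 1. -/
theorem card_keys_le {m : List Bool → ℝ} (hm : IsLowerSemicomputableSemimeasure m) (N : ℕ)
    (hN : 0 < N) (K : Finset (List Bool × ℕ))
    (hK : ∀ k ∈ K, ((k.2 + 1 : ℕ) : ℝ) / N < m k.1) : K.card ≤ N := by
  classical
  have hN' : (0 : ℝ) < N := by exact_mod_cast hN
  have h1 : ∀ z ∈ K.image Prod.fst, ((K.filter fun k => k.1 = z).card : ℝ) ≤ m z * N := by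
    intro z _
    have h2 : (K.filter fun k => k.1 = z).card ≤ ⌊m z * N⌋₊ := by
      rw [← Finset.card_range ⌊m z * N⌋₊]
      refine Finset.card_le_card_of_injOn Prod.snd (fun k hk => ?_) (fun k hk k' hk' h => ?_)
      · obtain ⟨hkK, rfl⟩ := Finset.mem_filter.1 hk
        have h3 := hK k hkK
        rw [div_lt_iff₀ hN'] at h3
        exact Finset.mem_coe.2 (Finset.mem_range.2 (Nat.lt_of_succ_le (Nat.le_floor h3.le)))
      · exact Prod.ext ((Finset.mem_filter.1 hk).2.trans (Finset.mem_filter.1 hk').2.symm) h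
    exact (Nat.cast_le.2 h2).trans (Nat.floor_le (mul_nonneg (hm.1 z) hN'.le))
  have h2 : (K.card : ℝ) ≤ N := by
    rw [Finset.card_eq_sum_card_image Prod.fst K]
    push_cast
    calc _ ≤ ∑ z ∈ K.image Prod.fst, m z * N := Finset.sum_le_sum h1
      _ = (∑ z ∈ K.image Prod.fst, m z) * N := by rw [Finset.sum_mul]
      _ ≤ 1 * N := by
        gcongr
        exact (hm.2.1.sum_le_tsum _ fun z _ => hm.1 z).trans hm.2.2.1
      _ = N := one_mul _
  exact_mod_cast h2

/-- If the sets of `𝒜ⁿ` of size at most `2 ^ (l + 1)` that contain `x` and `y` have many keys, then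
one of them has small complexity. -/
theorem exists_model_complexity_le {V : List Bool →. List Bool} (hV : IsOptimalDecompressor V)
    {m : List Bool → ℝ} (hm : IsLowerSemicomputableSemimeasure m)
    {enc : Finset (List Bool) → List Bool} (henc : IsComputableEncoding enc)
    {𝒜 : Set (Finset (List Bool))} (h𝒜 : IsDecidableFamily 𝒜) :
    ∃ c : ℕ, ∀ (n l q : ℕ) (x y : List Bool) (K : Finset (List Bool × ℕ)),
      (∀ k ∈ K, ((k.2 + 1 : ℕ) : ℝ) / (2 ^ (10 * n) : ℕ) < m k.1 ∧
        ∃ A ∈ slice 𝒜 n, enc A = k.1 ∧ A.card ≤ 2 ^ (l + 1) ∧ x ∈ A ∧ y ∈ A) →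
      K.Nonempty → 2 ^ q * (13 * n + 2) ≤ K.card →
      ∃ A ∈ slice 𝒜 n, x ∈ A ∧ y ∈ A ∧ A.card ≤ 2 ^ (l + 1) ∧ ∃ b, b * 2 ^ q ≤ 2 ^ (10 * n) ∧
        complexity V (enc A) ≤ 2 * (Nat.pair n (Nat.pair l q)).size + b.size + c := by
  have hn : Primrec fun a : ℕ => a.unpair.1 := Primrec.fst.comp Primrec.unpair
  have hq : Primrec fun a : ℕ => a.unpair.2.unpair.2 :=
    Primrec.snd.comp (Primrec.unpair.comp (Primrec.snd.comp Primrec.unpair))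
  obtain ⟨c, hc⟩ := exists_cover_complexity_le hV (rePred_modelItem hm henc h𝒜)
    (Q := fun a => 2 ^ a.unpair.2.unpair.2) (θ := fun a => 2 ^ (2 * a.unpair.1))
    (primrec₂_pow.comp (Primrec.const 2) hq)
    (primrec₂_pow.comp (Primrec.const 2) (Primrec.nat_mul.comp (Primrec.const 2) hn))
  refine ⟨c, fun n l q x y K hK hKne hKq => ?_⟩
  have hcast : ((2 ^ (10 * n) - 1 : ℕ) : ℝ) + 1 = ((2 ^ (10 * n) : ℕ) : ℝ) := by
    rw [Nat.cast_sub Nat.one_le_two_pow]; simp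
  have hItem : ∀ B, ModelItem m enc 𝒜 (Nat.pair n (Nat.pair l q)) B ↔
      ((B.1.2 + 1 : ℕ) : ℝ) / (2 ^ (10 * n) : ℕ) < m B.1.1 ∧
      ∃ L : List (List Bool), ListsModel enc 𝒜 n B.1.1 L ∧
      L.Nodup ∧ L.length ≤ 2 ^ (l + 1) ∧ B.2 = L.flatMap fun x => L.map fun y => (x, y) := by
    intro B
    simp only [ModelItem, Nat.unpair_pair, hcast]
  have hmem : ∀ (L : List (List Bool)) (u : List Bool × List Bool),
      u ∈ (L.flatMap fun x => L.map fun y => (x, y)) ↔ u.1 ∈ L ∧ u.2 ∈ L := by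
    rintro L ⟨x, y⟩
    simp
  obtain ⟨k₀, hk₀⟩ := hKne
  have hxy : x.length = n ∧ y.length = n := by
    obtain ⟨-, A, hA, -, -, hx, hy⟩ := hK k₀ hk₀
    exact ⟨(mem_slice.1 hA).2 x hx, (mem_slice.1 hA).2 y hy⟩
  -- There are 2^(2n) points and at most 2^(10n) keys; D = 13n + 2 makes 2^D exceed the potential
  -- bound 2^(2n) (1 + 2^(10n-q)) for every q.
  obtain ⟨k, P, b, hR, hu, hb, hC⟩ := hc (Nat.pair n (Nat.pair l q)) (by positivity)
    (by positivity) (bitStrings n ×ˢ bitStrings n) (2 ^ (10 * n)) (13 * n + 2)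
    (by
      rw [Finset.card_product, card_bitStrings, Nat.unpair_pair, ← pow_add, two_mul])
    (by
      intro B hB
      obtain ⟨-, L, hL, hnd, -, hP⟩ := (hItem B).1 hB
      rw [hP]
      refine ⟨hnd.product hnd, fun u hu => ?_⟩
      rw [hmem] at hu
      exact Finset.mem_product.2 ⟨mem_bitStrings.2 (hL.2.2 _ hu.1),
        mem_bitStrings.2 (hL.2.2 _ hu.2)⟩)
    (by
      intro B B' hB hB' hBB' u hu
      obtain ⟨-, L, hL, -, -, hP⟩ := (hItem B).1 hB
      obtain ⟨-, L', hL', -, -, hP'⟩ := (hItem B').1 hB'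
      rw [hP, hmem] at hu
      rw [hP', hmem]
      have h1 : L.toFinset = L'.toFinset := henc.1 (by rw [← hL.1, ← hL'.1, hBB'])
      simp only [Finset.ext_iff, List.mem_toFinset] at h1
      exact ⟨(h1 _).1 hu.1, (h1 _).1 hu.2⟩)
    (by
      intro K' hK'
      refine card_keys_le hm _ (by positivity) K' fun k hk => ?_
      obtain ⟨P, hP⟩ := hK' k hk
      exact ((hItem _).1 hP).1)
    (by
      simp only [Nat.unpair_pair]
      have h1 : 2 ^ (2 * n) * 2 ^ (10 * n) = 2 ^ (12 * n) := by rw [← pow_add]; congr 1; ring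
      have h2 : 2 ^ (2 * n) ≤ 2 ^ (12 * n) := Nat.pow_le_pow_right (by norm_num) (by omega)
      have h3 : 2 ^ (12 * n) ≤ 2 ^ (13 * n) := Nat.pow_le_pow_right (by norm_num) (by omega)
      have h4 : 1 ≤ 2 ^ q := Nat.one_le_two_pow
      have h5 : 1 ≤ 2 ^ (12 * n) := Nat.one_le_two_pow
      have h6 : 1 * 1 ≤ 2 ^ q * 2 ^ (12 * n) := Nat.mul_le_mul h4 h5
      calc 2 ^ (2 * n) * (2 ^ q + 2 ^ (10 * n)) = 2 ^ (2 * n) * 2 ^ q + 2 ^ (12 * n) := by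
            rw [mul_add, h1]
        _ ≤ 2 ^ (12 * n) * 2 ^ q + 2 ^ (12 * n) * 2 ^ q := by
            gcongr
            exact Nat.le_mul_of_pos_right _ h4
        _ < 2 ^ q * (2 ^ (12 * n) * 4) := by nlinarith
        _ ≤ 2 ^ q * (2 ^ (13 * n) * 4) := by gcongr
        _ = 2 ^ q * 2 ^ (13 * n + 2) := by rw [pow_add 2 (13 * n)]; norm_num)
    (x, y) K
    (Finset.mem_product.2 ⟨mem_bitStrings.2 hxy.1, mem_bitStrings.2 hxy.2⟩)
    (by
      intro k hk
      obtain ⟨hk1, A, hA, hAk, hcard, hx, hy⟩ := hK k hk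
      refine ⟨_, (hItem _).2 ⟨hk1, A.toList, hAk ▸ listsModel_toList enc hA,
        Finset.nodup_toList A, by rwa [Finset.length_toList], rfl⟩, ?_⟩
      exact (hmem _ _).2 ⟨Finset.mem_toList.2 hx, Finset.mem_toList.2 hy⟩)
    (by simpa only [Nat.unpair_pair] using hKq)
  obtain ⟨-, L, hL, -, hlen, hP⟩ := (hItem _).1 hR
  simp only at hL hP
  rw [hP, hmem] at hu
  refine ⟨L.toFinset, hL.mem_slice, List.mem_toFinset.2 hu.1, List.mem_toFinset.2 hu.2,
    (List.toFinset_card_le _).trans hlen, b, by simpa only [Nat.unpair_pair] using hb, ?_⟩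
  rw [← hL.1]
  exact hC

/-! ### Numerical bounds -/

theorem two_pow_size_le (a : ℕ) : 2 ^ a.size ≤ 2 * a + 1 := by
  rcases Nat.eq_zero_or_pos a with rfl | ha
  · simp
  · have h1 : a.size - 1 < a.size := Nat.sub_lt (Nat.size_pos.2 ha) one_pos
    have h2 := Nat.lt_size.1 h1
    have h3 : 2 ^ a.size = 2 * 2 ^ (a.size - 1) := by
      rw [← pow_succ', Nat.sub_add_cancel (Nat.size_pos.2 ha)]
    omega

/-- With `two_pow_size_le` this makes the self-delimiting description of n, l, q cost only O(log n)
bits. -/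
theorem pair_parameters_le {n l q : ℕ} (hn : 2 ≤ n) (hl : l ≤ n) (hq : q ≤ 10 * n) :
    2 * Nat.pair n (Nat.pair l q) + 1 ≤ n ^ 21 := by
  have hn1 : 1 ≤ n := by omega
  have h1 : 10 * n + 1 ≤ n ^ 5 := by
    have h : 2 ^ 4 ≤ n ^ 4 := Nat.pow_le_pow_left hn 4
    calc 10 * n + 1 ≤ 2 ^ 4 * n := by omega
      _ ≤ n ^ 4 * n := by gcongr
      _ = n ^ 5 := by ring
  have h2 : Nat.pair l q + 1 ≤ n ^ 10 := by
    have h := Nat.pair_lt_max_add_one_sq l q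
    have h' : max l q + 1 ≤ 10 * n + 1 := by
      have : max l q ≤ 10 * n := max_le (by omega) hq
      omega
    calc Nat.pair l q + 1 ≤ (max l q + 1) ^ 2 := h
      _ ≤ (n ^ 5) ^ 2 := Nat.pow_le_pow_left (h'.trans h1) 2
      _ = n ^ 10 := by ring
  have h3 : n + 1 ≤ n ^ 10 := le_trans (by omega) (h1.trans (Nat.pow_le_pow_right hn1 (by norm_num)))
  have h4 : Nat.pair n (Nat.pair l q) + 1 ≤ n ^ 20 := by
    have h := Nat.pair_lt_max_add_one_sq n (Nat.pair l q)
    have h' : max n (Nat.pair l q) + 1 ≤ n ^ 10 := by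
      rcases max_cases n (Nat.pair l q) with ⟨h, -⟩ | ⟨h, -⟩ <;> rw [h] <;> assumption
    calc _ ≤ (max n (Nat.pair l q) + 1) ^ 2 := h
      _ ≤ (n ^ 10) ^ 2 := Nat.pow_le_pow_left h' 2
      _ = n ^ 20 := by ring
  calc 2 * Nat.pair n (Nat.pair l q) + 1 ≤ 2 * n ^ 20 := by omega
    _ ≤ n * n ^ 20 := by gcongr
    _ = n ^ 21 := by ring

/-! ### The sum over models is comparable to its largest term -/

open Classical in
/-- The index set of `modelSum` for the pair `{x, y}`. -/
theorem mem_modelFilter {V : List Bool →. List Bool} {enc : Finset (List Bool) → List Bool}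
    {𝒜 : Set (Finset (List Bool))} {n : ℕ} {x y : List Bool} {A : Finset (List Bool)} :
    A ∈ (slice 𝒜 n).filter (fun A => complexity V (enc A) ≤ 4 * n ∧
      ∀ s ∈ ({x, y} : Set (List Bool)), s ∈ A) ↔
      A ∈ slice 𝒜 n ∧ complexity V (enc A) ≤ 4 * n ∧ x ∈ A ∧ y ∈ A := by
  simp

theorem card_le_of_mem_slice {𝒜 : Set (Finset (List Bool))} {n : ℕ} {A : Finset (List Bool)}
    (hA : A ∈ slice 𝒜 n) : A.card ≤ 2 ^ n := by
  rw [← card_bitStrings]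
  exact Finset.card_le_card fun a ha => mem_bitStrings.2 ((mem_slice.1 hA).2 a ha)

/-- Among finitely many models there is a size class that carries at least the average share of the
sum, up to a factor of two. -/
theorem exists_size_class {𝒜 : Set (Finset (List Bool))} {n : ℕ}
    (F : Finset (Finset (List Bool))) (hF : ∀ A ∈ F, A ∈ slice 𝒜 n ∧ A.Nonempty)
    (w : Finset (List Bool) → ℝ) (hw : ∀ A, 0 ≤ w A) :
    ∃ l ≤ n, ∑ A ∈ F, w A / (A.card : ℝ) ≤
      (n + 1) * ((∑ A ∈ F with Nat.log 2 A.card = l, w A) / 2 ^ l) := by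
  obtain ⟨l, hl, hmax⟩ := Finset.exists_max_image (Finset.range (n + 1))
    (fun l => (∑ A ∈ F with Nat.log 2 A.card = l, w A) / (2 : ℝ) ^ l) ⟨0, by simp⟩
  refine ⟨l, Nat.lt_succ_iff.1 (Finset.mem_range.1 hl), ?_⟩
  rw [← Finset.sum_fiberwise_of_maps_to (g := fun A => Nat.log 2 A.card) (t := Finset.range (n + 1))
    (fun A hA => Finset.mem_range.2 (Nat.lt_succ_of_le (by
      have h := Nat.log_mono_right (b := 2) (card_le_of_mem_slice (hF A hA).1)
      rwa [Nat.log_pow (by norm_num)] at h)))]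
  have h1 : ∀ i ∈ Finset.range (n + 1), ∑ A ∈ F with Nat.log 2 A.card = i, w A / (A.card : ℝ) ≤
      (∑ A ∈ F with Nat.log 2 A.card = l, w A) / (2 : ℝ) ^ l := by
    intro i hi
    refine le_trans ?_ (hmax i hi)
    rw [Finset.sum_div]
    refine Finset.sum_le_sum fun A hA => ?_
    obtain ⟨hAF, rfl⟩ := Finset.mem_filter.1 hA
    have h2 : 2 ^ Nat.log 2 A.card ≤ A.card :=
      Nat.pow_log_le_self 2 (Finset.card_pos.2 (hF A hAF).2).ne'
    have h3 : (2 : ℝ) ^ Nat.log 2 A.card ≤ A.card := by exact_mod_cast h2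
    exact div_le_div_of_nonneg_left (hw A) (by positivity) h3
  refine (Finset.sum_le_card_nsmul _ _ _ h1).trans (le_of_eq ?_)
  rw [Finset.card_range, nsmul_eq_mul]
  push_cast
  rfl

/-- The keys of the models of `F`: each model `A` has about `N m(A)` keys. -/
noncomputable def keys (m : List Bool → ℝ) (enc : Finset (List Bool) → List Bool) (N : ℕ)
    (F : Finset (Finset (List Bool))) : Finset (List Bool × ℕ) :=
  F.biUnion fun A => (Finset.range (⌈m (enc A) * N⌉₊ - 1)).map
    ⟨fun j => (enc A, j), fun _ _ h => (Prod.ext_iff.1 h).2⟩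

theorem mem_keys {m : List Bool → ℝ} {enc : Finset (List Bool) → List Bool} {N : ℕ}
    (hN : 0 < N) {F : Finset (Finset (List Bool))} {k : List Bool × ℕ} (hk : k ∈ keys m enc N F) :
    ((k.2 + 1 : ℕ) : ℝ) / N < m k.1 ∧ ∃ A ∈ F, enc A = k.1 := by
  obtain ⟨A, hA, hk⟩ := Finset.mem_biUnion.1 hk
  obtain ⟨j, hj, rfl⟩ := Finset.mem_map.1 hk
  have hN' : (0 : ℝ) < N := by exact_mod_cast hN
  refine ⟨?_, A, hA, rfl⟩
  rw [div_lt_iff₀ hN']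
  refine Nat.lt_ceil.1 ?_
  have := Finset.mem_range.1 hj
  show j + 1 < ⌈m (enc A) * N⌉₊
  omega

/-- Rounding costs at most one key per model, hence the term `F.card`. -/
theorem le_card_keys {m : List Bool → ℝ} {enc : Finset (List Bool) → List Bool}
    (henc : Function.Injective enc) (N : ℕ) (F : Finset (Finset (List Bool))) :
    (∑ A ∈ F, m (enc A)) * N - F.card ≤ (keys m enc N F).card := by
  rw [keys, Finset.card_biUnion]
  · push_cast
    rw [Finset.sum_mul, ← nsmul_one F.card, ← Finset.sum_const, ← Finset.sum_sub_distrib]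
    refine Finset.sum_le_sum fun A _ => ?_
    rw [Finset.card_map, Finset.card_range]
    have h1 := Nat.le_ceil (m (enc A) * N)
    have h2 : (⌈m (enc A) * N⌉₊ : ℝ) ≤ ((⌈m (enc A) * N⌉₊ - 1 : ℕ) : ℝ) + 1 := by
      exact_mod_cast Nat.le_add_of_sub_le le_rfl
    linarith
  · intro A _ B _ hAB
    rw [Function.onFun, Finset.disjoint_left]
    intro k hk hk'
    obtain ⟨j, -, rfl⟩ := Finset.mem_map.1 hk
    obtain ⟨j', -, h⟩ := Finset.mem_map.1 hk'
    exact hAB (henc (Prod.ext_iff.1 h).1.symm)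

/-- `2 ^ (-C(A)) / |A|`, the weight of the model `A`. -/
noncomputable def modelWeight (V : List Bool →. List Bool) (enc : Finset (List Bool) → List Bool)
    (A : Finset (List Bool)) : ℝ :=
  1 / (2 ^ complexity V (enc A) * (A.card : ℝ))

/-- This floor handles the cases where the sum is too small for counting keys, or n too small for
replacing models. -/
theorem pow_le_modelWeight {V : List Bool →. List Bool} {enc : Finset (List Bool) → List Bool}
    {𝒜 : Set (Finset (List Bool))} {n : ℕ} {A : Finset (List Bool)} (hA : A ∈ slice 𝒜 n)
    (hne : A.Nonempty) (hC : complexity V (enc A) ≤ 4 * n) :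
    1 / (2 : ℝ) ^ (5 * n) ≤ modelWeight V enc A := by
  have h1 : (0 : ℝ) < A.card := by exact_mod_cast Finset.card_pos.2 hne
  have h2 : (A.card : ℝ) ≤ 2 ^ n := by exact_mod_cast card_le_of_mem_slice hA
  unfold modelWeight
  refine one_div_le_one_div_of_le (by positivity) ?_
  calc (2 : ℝ) ^ complexity V (enc A) * A.card ≤ 2 ^ (4 * n) * 2 ^ n := by
        gcongr
        norm_num
    _ = 2 ^ (5 * n) := by rw [← pow_add]; congr 1; ring

/-- The share of a size class with many keys is bounded by the weight of a single model. -/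
theorem exists_model_of_many_keys {V : List Bool →. List Bool} (hV : IsOptimalDecompressor V)
    {m : List Bool → ℝ} (hm : IsLowerSemicomputableSemimeasure m)
    {enc : Finset (List Bool) → List Bool} (henc : IsComputableEncoding enc)
    {𝒜 : Set (Finset (List Bool))} (h𝒜 : IsDecidableFamily 𝒜) :
    ∃ c : ℕ, ∀ (n l : ℕ) (x y : List Bool) (K : Finset (List Bool × ℕ)), 2 ≤ n → l ≤ n →
      (∀ k ∈ K, ((k.2 + 1 : ℕ) : ℝ) / (2 ^ (10 * n) : ℕ) < m k.1 ∧
        ∃ A ∈ slice 𝒜 n, enc A = k.1 ∧ A.card ≤ 2 ^ (l + 1) ∧ x ∈ A ∧ y ∈ A) →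
      13 * n + 2 ≤ K.card →
      ∃ A ∈ slice 𝒜 n, x ∈ A ∧ y ∈ A ∧
        (K.card : ℝ) / (2 ^ (10 * n) * 2 ^ l) ≤ (n : ℝ) ^ c * modelWeight V enc A := by
  obtain ⟨c, hc⟩ := exists_model_complexity_le hV hm henc h𝒜
  refine ⟨c + 51, fun n l x y K hn hl hK hKD => ?_⟩
  set D := 13 * n + 2 with hD
  -- The largest q with 2^q D ≤ |K|, so that |K| and 2^q D agree up to a factor of 2.
  set q := Nat.log 2 (K.card / D) with hq
  have hDpos : 0 < D := by omega
  have hdiv : K.card / D ≠ 0 := (Nat.div_pos hKD hDpos).ne'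
  have hq1 : 2 ^ q * D ≤ K.card :=
    (Nat.le_div_iff_mul_le hDpos).1 (Nat.pow_log_le_self 2 hdiv)
  have hq2 : K.card ≤ 2 ^ (q + 1) * D :=
    ((Nat.div_lt_iff_lt_mul hDpos).1 (Nat.lt_pow_succ_log_self (by norm_num) _)).le
  have hKne : K.Nonempty := Finset.card_pos.1 (by omega)
  have hKN : K.card ≤ 2 ^ (10 * n) :=
    card_keys_le hm _ (by positivity) K fun k hk => (hK k hk).1
  have hqN : 2 ^ q ≤ 2 ^ (10 * n) := (Nat.le_mul_of_pos_right _ hDpos).trans (hq1.trans hKN)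
  have hq10 : q ≤ 10 * n := (Nat.pow_le_pow_iff_right (by norm_num)).1 hqN
  obtain ⟨A, hA, hx, hy, hcard, b, hb, hC⟩ := hc n l q x y K hK hKne hq1
  refine ⟨A, hA, hx, hy, ?_⟩
  have hApos : 0 < A.card := Finset.card_pos.2 ⟨x, hx⟩
  have h1 : 2 ^ complexity V (enc A) * 2 ^ q ≤ n ^ (c + 42) * (4 * 2 ^ (10 * n)) := by
    set a := Nat.pair n (Nat.pair l q) with ha
    have h2 : 2 ^ a.size ≤ n ^ 21 := (two_pow_size_le a).trans (pair_parameters_le hn hl hq10)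
    -- The position b is at most 2^(10n-q), so its binary expansion has about 10n - q bits.
    have h3 : 2 ^ b.size * 2 ^ q ≤ 4 * 2 ^ (10 * n) := by
      calc 2 ^ b.size * 2 ^ q ≤ (2 * b + 1) * 2 ^ q := by gcongr; exact two_pow_size_le b
        _ = 2 * (b * 2 ^ q) + 2 ^ q := by ring
        _ ≤ 4 * 2 ^ (10 * n) := by omega
    calc 2 ^ complexity V (enc A) * 2 ^ q ≤ 2 ^ (2 * a.size + b.size + c) * 2 ^ q := by
          gcongr
          norm_num
      _ = (2 ^ a.size) ^ 2 * 2 ^ c * (2 ^ b.size * 2 ^ q) := by ring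
      _ ≤ (n ^ 21) ^ 2 * n ^ c * (4 * 2 ^ (10 * n)) := by gcongr
      _ = n ^ (c + 42) * (4 * 2 ^ (10 * n)) := by ring
  have h4 : 16 * D ≤ n ^ 9 := by
    have h : 2 ^ 8 ≤ n ^ 8 := Nat.pow_le_pow_left hn 8
    calc 16 * D ≤ 2 ^ 8 * n := by omega
      _ ≤ n ^ 8 * n := by gcongr
      _ = n ^ 9 := by ring
  have h5 : K.card * (2 ^ complexity V (enc A) * A.card) ≤
      n ^ (c + 51) * (2 ^ (10 * n) * 2 ^ l) := by
    calc K.card * (2 ^ complexity V (enc A) * A.card)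
        ≤ (2 ^ (q + 1) * D) * (2 ^ complexity V (enc A) * 2 ^ (l + 1)) := by gcongr
      _ = 4 * D * 2 ^ l * (2 ^ complexity V (enc A) * 2 ^ q) := by ring
      _ ≤ 4 * D * 2 ^ l * (n ^ (c + 42) * (4 * 2 ^ (10 * n))) := by gcongr
      _ = 16 * D * (n ^ (c + 42) * (2 ^ (10 * n) * 2 ^ l)) := by ring
      _ ≤ n ^ 9 * (n ^ (c + 42) * (2 ^ (10 * n) * 2 ^ l)) := by gcongr
      _ = n ^ (c + 51) * (2 ^ (10 * n) * 2 ^ l) := by ring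
  have h6 : (0 : ℝ) < A.card := by exact_mod_cast hApos
  rw [modelWeight, mul_one_div, div_le_div_iff₀ (by positivity) (by positivity)]
  exact_mod_cast h5

/-- The sum over the models that contain `x` and `y` is, up to a polynomial factor, at most the
weight of one of them. -/
theorem exists_modelSum_le {V : List Bool →. List Bool} (hV : IsOptimalDecompressor V)
    {m : List Bool → ℝ} (hm : IsLowerSemicomputableSemimeasure m)
    {enc : Finset (List Bool) → List Bool} (henc : IsComputableEncoding enc)
    {𝒜 : Set (Finset (List Bool))} (h𝒜 : IsDecidableFamily 𝒜) :
    ∃ c : ℕ, ∀ (n : ℕ) (x y : List Bool), 2 ≤ n → 0 < modelSum V m enc 𝒜 n {x, y} →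
      ∃ A ∈ slice 𝒜 n, x ∈ A ∧ y ∈ A ∧
        modelSum V m enc 𝒜 n {x, y} ≤ (n : ℝ) ^ c * modelWeight V enc A := by
  classical
  obtain ⟨c, hc⟩ := exists_model_of_many_keys hV hm henc h𝒜
  refine ⟨c + 8, fun n x y hn hS => ?_⟩
  obtain ⟨F, hF, hSF⟩ : ∃ F : Finset (Finset (List Bool)),
      (∀ A, A ∈ F ↔ A ∈ slice 𝒜 n ∧ complexity V (enc A) ≤ 4 * n ∧ x ∈ A ∧ y ∈ A) ∧
      modelSum V m enc 𝒜 n {x, y} = ∑ A ∈ F, m (enc A) / (A.card : ℝ) :=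
    ⟨_, fun A => mem_modelFilter, rfl⟩
  rw [hSF] at hS ⊢
  obtain ⟨A₀, hA₀⟩ : F.Nonempty := by
    rw [Finset.nonempty_iff_ne_empty]
    rintro rfl
    simp at hS
  obtain ⟨l, hl, hsum⟩ := exists_size_class F
    (fun A hA => ⟨((hF A).1 hA).1, ⟨x, ((hF A).1 hA).2.2.1⟩⟩) (fun A => m (enc A))
    (fun A => hm.1 _)
  set G := F.filter fun A => Nat.log 2 A.card = l with hG
  set σ := ∑ A ∈ G, m (enc A) with hσ
  have hσ0 : 0 ≤ σ := Finset.sum_nonneg fun A _ => hm.1 _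
  have hGF : ∀ A ∈ G, A ∈ F := fun A hA => (Finset.mem_filter.1 hA).1
  -- The complexity cutoff bounds the number of models, and with it the number of keys lost to
  -- rounding.
  have hGcard : G.card ≤ 2 ^ (4 * n + 1) := by
    rw [← Finset.card_image_of_injective G henc.1]
    refine card_complexity_le hV _ _ fun z hz => ?_
    obtain ⟨A, hA, rfl⟩ := Finset.mem_image.1 hz
    exact ((hF A).1 (hGF A hA)).2.1
  have hcardK := le_card_keys (m := m) henc.1 (2 ^ (10 * n)) G
  rw [← hσ] at hcardK
  set K := keys m enc (2 ^ (10 * n)) G with hKdef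
  have hGcard' : (G.card : ℝ) ≤ 2 ^ (4 * n + 1) := by exact_mod_cast hGcard
  have hn1 : (1 : ℝ) ≤ n := by exact_mod_cast (by omega : 1 ≤ n)
  have hn2 : (2 : ℝ) ≤ n := by exact_mod_cast hn
  have hn12 : (n : ℝ) + 1 ≤ n ^ 2 := by nlinarith
  have hw : ∀ A, 0 ≤ modelWeight V enc A := fun A => by unfold modelWeight; positivity
  have hpowl : (1 : ℝ) ≤ 2 ^ l := one_le_pow₀ (by norm_num)
  push_cast at hcardK
  -- Either the keys account for at least half of the mass and are numerous enough for covering, or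
  -- the mass is O(2^(-5n)), and then any model in the sum will do.
  rcases le_or_gt (2 * ((13 * n + 2) + 2 ^ (4 * n + 1)) : ℝ) (σ * 2 ^ (10 * n)) with hcase | hcase
  · have hp : (0 : ℝ) < 2 ^ (4 * n + 1) := by positivity
    have hKD : 13 * n + 2 ≤ K.card := by
      have h : ((13 * n + 2 : ℕ) : ℝ) ≤ K.card := by
        push_cast
        linarith
      exact_mod_cast h
    have hσK : σ * 2 ^ (10 * n) ≤ 2 * K.card := by linarith
    obtain ⟨A, hA, hx, hy, hAw⟩ := hc n l x y K hn hl (fun k hk => by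
      obtain ⟨h1, A, hA, hAk⟩ := mem_keys (by positivity) hk
      have hAF := (hF A).1 (hGF A hA)
      refine ⟨h1, A, hAF.1, hAk, ?_, hAF.2.2⟩
      rw [← (Finset.mem_filter.1 hA).2]
      exact (Nat.lt_pow_succ_log_self (by norm_num) _).le) hKD
    refine ⟨A, hA, hx, hy, hsum.trans ?_⟩
    have h1 : σ / 2 ^ l ≤ 2 * ((K.card : ℝ) / (2 ^ (10 * n) * 2 ^ l)) := by
      rw [← mul_div_assoc, div_le_div_iff₀ (by positivity) (by positivity)]
      calc σ * (2 ^ (10 * n) * 2 ^ l) = σ * 2 ^ (10 * n) * 2 ^ l := by ring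
        _ ≤ 2 * K.card * 2 ^ l := by gcongr
    calc (n + 1 : ℝ) * (σ / 2 ^ l)
        ≤ n ^ 2 * (2 * ((n : ℝ) ^ c * modelWeight V enc A)) := by
          gcongr
          exact h1.trans (by gcongr)
      _ ≤ n ^ 2 * (n ^ 6 * ((n : ℝ) ^ c * modelWeight V enc A)) := by
          have : (2 : ℝ) ≤ n ^ 6 := hn2.trans (le_self_pow₀ hn1 (by norm_num))
          have := hw A
          gcongr
      _ = (n : ℝ) ^ (c + 8) * modelWeight V enc A := by ring
  · have hA₀F := (hF A₀).1 hA₀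
    refine ⟨A₀, hA₀F.1, hA₀F.2.2.1, hA₀F.2.2.2, hsum.trans ?_⟩
    have h1 := pow_le_modelWeight (V := V) (enc := enc) hA₀F.1 ⟨x, hA₀F.2.2.1⟩ hA₀F.2.1
    -- Here 34 = 2 (15 + 2), from bounding 13n + 2 by 15 · 2^(5n) and 2^(4n+1) by 2 · 2^(5n).
    have h2 : σ ≤ 34 * (1 / 2 ^ (5 * n)) := by
      have h3 : (13 * n + 2 : ℝ) ≤ 15 * 2 ^ (5 * n) := by
        have h4 : n < 2 ^ n := Nat.lt_two_pow_self
        have h5 : 2 ^ n ≤ 2 ^ (5 * n) := Nat.pow_le_pow_right (by norm_num) (by omega)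
        have h6 : 13 * n + 2 ≤ 15 * 2 ^ (5 * n) := by omega
        exact_mod_cast h6
      have h4 : (2 : ℝ) ^ (4 * n + 1) ≤ 2 * 2 ^ (5 * n) := by
        rw [pow_succ, mul_comm]
        gcongr
        · norm_num
        · norm_num
      have h5 : (2 : ℝ) ^ (10 * n) = 2 ^ (5 * n) * 2 ^ (5 * n) := by
        rw [← pow_add]; congr 1; ring
      have h6 : (0 : ℝ) < 2 ^ (5 * n) := by positivity
      rw [h5, ← mul_assoc] at hcase
      rw [mul_one_div, le_div_iff₀ h6]
      have h7 : σ * 2 ^ (5 * n) * 2 ^ (5 * n) ≤ 34 * 2 ^ (5 * n) := by linarith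
      exact le_of_mul_le_mul_right h7 h6
    have h3 : σ / 2 ^ l ≤ 34 * modelWeight V enc A₀ :=
      (div_le_self hσ0 hpowl).trans (h2.trans (by gcongr))
    have h4 : (34 : ℝ) ≤ n ^ 6 := by
      calc (34 : ℝ) ≤ 2 ^ 6 := by norm_num
        _ ≤ n ^ 6 := by gcongr
    have h5 := hw A₀
    calc (n + 1 : ℝ) * (σ / 2 ^ l) ≤ n ^ 2 * (n ^ 6 * modelWeight V enc A₀) := by
          gcongr
          exact h3.trans (by gcongr)
      _ = (n : ℝ) ^ 8 * modelWeight V enc A₀ := by ring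
      _ ≤ (n : ℝ) ^ (c + 8) * modelWeight V enc A₀ := by
          gcongr
          omega

/-! ### Weights of single models against the sum -/

theorem modelSum_nonneg {V : List Bool →. List Bool} {m : List Bool → ℝ} (hm : ∀ x, 0 ≤ m x)
    (enc : Finset (List Bool) → List Bool) (𝒜 : Set (Finset (List Bool))) (n : ℕ)
    (S : Set (List Bool)) : 0 ≤ modelSum V m enc 𝒜 n S :=
  Finset.sum_nonneg fun _ _ => div_nonneg (hm _) (Nat.cast_nonneg _)

theorem modelWeight_pos (V : List Bool →. List Bool) (enc : Finset (List Bool) → List Bool)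
    {A : Finset (List Bool)} (hA : A.Nonempty) : 0 < modelWeight V enc A := by
  have : (0 : ℝ) < A.card := by exact_mod_cast Finset.card_pos.2 hA
  unfold modelWeight
  positivity

/-- The weight of a model of complexity at most `4 n` is bounded by the sum over models. -/
theorem exists_modelWeight_le {V : List Bool →. List Bool} (hV : IsOptimalDecompressor V)
    {m : List Bool → ℝ} (hm : IsAPrioriProbability m) (enc : Finset (List Bool) → List Bool)
    (𝒜 : Set (Finset (List Bool))) :
    ∃ c : ℕ, ∀ n, 2 ≤ n → ∀ A ∈ slice 𝒜 n, complexity V (enc A) ≤ 4 * n → ∀ x ∈ A, ∀ y ∈ A,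
      modelWeight V enc A ≤ (n : ℝ) ^ c * modelSum V m enc 𝒜 n {x, y} := by
  classical
  obtain ⟨c₀, hc₀, h⟩ := exists_le_apriori hV hm
  -- Since n ≥ 2, the constant is absorbed into `n ^ k`.
  obtain ⟨k, hk⟩ := pow_unbounded_of_one_lt c₀ (one_lt_two (α := ℝ))
  refine ⟨k + 8, fun n hn A hA hC x hx y hy => ?_⟩
  have hn2 : (2 : ℝ) ≤ n := by exact_mod_cast hn
  have hC' : (complexity V (enc A) : ℝ) ≤ 4 * n := by exact_mod_cast hC
  have hm0 := hm.1.1 (enc A)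
  have h4 : (4 * n + 2 : ℝ) ≤ n ^ 4 := by
    have : (2 : ℝ) ^ 3 ≤ n ^ 3 := by gcongr
    nlinarith
  have h1 : 1 / (2 : ℝ) ^ complexity V (enc A) ≤ n ^ (k + 8) * m (enc A) := by
    refine (h (enc A)).trans ?_
    gcongr
    calc c₀ * (((complexity V (enc A) : ℝ) + 1) * (complexity V (enc A) + 2))
        ≤ 2 ^ k * ((4 * n + 2) * (4 * n + 2)) := by
          gcongr
          linarith
      _ ≤ n ^ k * (n ^ 4 * n ^ 4) := by gcongr
      _ = (n : ℝ) ^ (k + 8) := by ring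
  have h2 : m (enc A) / (A.card : ℝ) ≤ modelSum V m enc 𝒜 n {x, y} :=
    Finset.single_le_sum (f := fun A => m (enc A) / (A.card : ℝ))
      (fun _ _ => div_nonneg (hm.1.1 _) (Nat.cast_nonneg _))
      (mem_modelFilter.2 ⟨hA, hC, hx, hy⟩)
  calc modelWeight V enc A = 1 / (2 : ℝ) ^ complexity V (enc A) / A.card := by
        rw [modelWeight, div_div]
    _ ≤ n ^ (k + 8) * m (enc A) / A.card := by gcongr
    _ = n ^ (k + 8) * (m (enc A) / A.card) := by rw [mul_div_assoc]
    _ ≤ _ := by gcongr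

/-- For large `n`, a model of complexity more than `4 n` can be replaced by a better one. -/
theorem exists_better_model {V : List Bool →. List Bool} (hV : IsOptimalDecompressor V)
    {enc : Finset (List Bool) → List Bool} (henc : IsComputableEncoding enc)
    {𝒜 : Set (Finset (List Bool))} (h𝒜 : IsDecidableFamily 𝒜) :
    ∃ N : ℕ, ∀ n, N ≤ n → ∀ A ∈ slice 𝒜 n, ∀ x ∈ A, ∀ y ∈ A, ∃ B ∈ slice 𝒜 n, x ∈ B ∧ y ∈ B ∧
      complexity V (enc B) ≤ 4 * n ∧ modelWeight V enc A ≤ modelWeight V enc B := by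
  obtain ⟨c, hc⟩ := exists_common_model_complexity_le hV henc h𝒜
  refine ⟨c, fun n hn A hA x hx y hy => ?_⟩
  rcases le_or_gt (complexity V (enc A)) (4 * n) with hCA | hCA
  · exact ⟨A, hA, hx, hy, hCA, le_rfl⟩
  · obtain ⟨B, hB, hxB, hyB, hCB⟩ := hc n A hA x hx y hy
    refine ⟨B, hB, hxB, hyB, by omega, ?_⟩
    have hApos : 1 ≤ A.card := Finset.card_pos.2 ⟨x, hx⟩
    have hBpos : (0 : ℝ) < B.card := by exact_mod_cast Finset.card_pos.2 ⟨x, hxB⟩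
    refine one_div_le_one_div_of_le (by positivity) ?_
    -- As n ≥ c, C(B) ≤ 2n + c ≤ 3n, and |B| ≤ 2^n; the product stays below 2^C(A) because C(A) >
    -- 4n.
    have h : 2 ^ complexity V (enc B) * B.card ≤ 2 ^ complexity V (enc A) * A.card := by
      calc 2 ^ complexity V (enc B) * B.card ≤ 2 ^ (3 * n) * 2 ^ n :=
            Nat.mul_le_mul (Nat.pow_le_pow_right (by norm_num) (by omega))
              (card_le_of_mem_slice hB)
        _ = 2 ^ (4 * n) := by rw [← pow_add]; congr 1; ring
        _ ≤ 2 ^ complexity V (enc A) := Nat.pow_le_pow_right (by norm_num) hCA.le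
        _ ≤ _ := Nat.le_mul_of_pos_right _ hApos
    exact_mod_cast h

/-- If the sum over the models that contain `x` is positive, then it bounds the weight of each of
the members of `𝒜ⁿ` that contain `x`, of whatever complexity. -/
theorem exists_modelWeight_le_of_pos {V : List Bool →. List Bool} (hV : IsOptimalDecompressor V)
    {m : List Bool → ℝ} (hm : IsAPrioriProbability m)
    {enc : Finset (List Bool) → List Bool} (henc : IsComputableEncoding enc)
    {𝒜 : Set (Finset (List Bool))} (h𝒜 : IsDecidableFamily 𝒜) :
    ∃ c : ℕ, ∀ n, 2 ≤ n → ∀ x, 0 < modelSum V m enc 𝒜 n {x, x} → ∀ B ∈ slice 𝒜 n, x ∈ B →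
      modelWeight V enc B ≤ (n : ℝ) ^ c * modelSum V m enc 𝒜 n {x, x} := by
  classical
  obtain ⟨c, hc⟩ := exists_modelWeight_le hV hm enc 𝒜
  obtain ⟨N, hN⟩ := exists_better_model hV henc h𝒜
  refine ⟨c + 5 * N, fun n hn x hS B hB hx => ?_⟩
  have hn2 : (2 : ℝ) ≤ n := by exact_mod_cast hn
  have hn1 : (1 : ℝ) ≤ n := by linarith
  rcases le_or_gt N n with hNn | hNn
  · obtain ⟨A, hA, hxA, -, hCA, hBA⟩ := hN n hNn B hB x hx x hx
    refine hBA.trans ((hc n hn A hA hCA x hxA x hxA).trans ?_)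
    gcongr
    omega
  -- For n < N a replacement may not exist, but positivity supplies a model of weight at least
  -- 2^(-5n), while all weights are at most 1. The loss is bounded by 2^(5N) ≤ n^(5N), which lets
  -- part (b) hold from n = 2 on.
  · obtain ⟨A, hA⟩ : ∃ A, A ∈ slice 𝒜 n ∧ complexity V (enc A) ≤ 4 * n ∧ x ∈ A ∧ x ∈ A := by
      by_contra hcon
      refine hS.ne' (Finset.sum_eq_zero fun A hA => absurd ⟨A, mem_modelFilter.1 hA⟩ hcon)
    have h1 := pow_le_modelWeight (V := V) (enc := enc) hA.1 ⟨x, hA.2.2.1⟩ hA.2.1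
    have h2 := hc n hn A hA.1 hA.2.1 x hA.2.2.1 x hA.2.2.1
    have h3 : modelWeight V enc B ≤ 1 := by
      have hB1 : (1 : ℝ) ≤ B.card := by exact_mod_cast Finset.card_pos.2 ⟨x, hx⟩
      have hB2 : (1 : ℝ) ≤ 2 ^ complexity V (enc B) := one_le_pow₀ (by norm_num)
      rw [modelWeight, div_le_one (by positivity)]
      nlinarith
    have h4 : (2 : ℝ) ^ (5 * n) ≤ n ^ (5 * N) := by
      calc (2 : ℝ) ^ (5 * n) ≤ 2 ^ (5 * N) := by
            gcongr
            norm_num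
        _ ≤ n ^ (5 * N) := by gcongr
    rw [div_le_iff₀ (by positivity)] at h1
    calc modelWeight V enc B ≤ modelWeight V enc A * 2 ^ (5 * n) := h3.trans h1
      _ ≤ (n : ℝ) ^ c * modelSum V m enc 𝒜 n {x, x} * n ^ (5 * N) := by gcongr
      _ = _ := by ring

theorem modelWeight_eq_rpow {V : List Bool →. List Bool} {enc : Finset (List Bool) → List Bool}
    {A : Finset (List Bool)} (hA : A.Nonempty) :
    modelWeight V enc A = (2 : ℝ) ^ (-((complexity V (enc A) : ℝ) + Real.logb 2 A.card)) := by
  have h : (0 : ℝ) < A.card := by exact_mod_cast Finset.card_pos.2 hA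
  rw [Real.rpow_neg (by norm_num), Real.rpow_add (by norm_num), Real.rpow_natCast,
    Real.rpow_logb (by norm_num) (by norm_num) h, modelWeight, one_div]

/-- The term C(x) is common to both sides; exponentiation turns deficiencies into weights. -/
theorem deficiency_le_iff {V : List Bool →. List Bool} {enc : Finset (List Bool) → List Bool}
    {x : List Bool} {A B : Finset (List Bool)} (hA : A.Nonempty) (hB : B.Nonempty) (d : ℝ) :
    deficiency V enc x A ≤ deficiency V enc x B + d ↔
      modelWeight V enc B ≤ (2 : ℝ) ^ d * modelWeight V enc A := by
  rw [modelWeight_eq_rpow hA, modelWeight_eq_rpow hB, ← Real.rpow_add (by norm_num),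
    Real.rpow_le_rpow_left_iff (by norm_num), deficiency, deficiency]
  constructor <;> intro h <;> linarith

theorem rpow_add_mul_logb {n : ℕ} (hn : 2 ≤ n) (d : ℝ) (c : ℕ) :
    (2 : ℝ) ^ (d + (c : ℝ) * Real.logb 2 n) = 2 ^ d * (n : ℝ) ^ c := by
  have h : (0 : ℝ) < n := by exact_mod_cast (by omega : 0 < n)
  rw [Real.rpow_add (by norm_num), mul_comm (c : ℝ), Real.rpow_mul (by norm_num),
    Real.rpow_logb (by norm_num) (by norm_num) h, Real.rpow_natCast]

end AlgStat

/-! ### The two inclusions -/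

theorem mainTheorem3 (V : List Bool →. List Bool) (hV : AlgStat.IsOptimalDecompressor V)
    (m : List Bool → ℝ) (hm : AlgStat.IsAPrioriProbability m)
    (enc : Finset (List Bool) → List Bool) (henc : AlgStat.IsComputableEncoding enc)
    (𝒜 : Set (Finset (List Bool))) (h𝒜 : AlgStat.IsDecidableFamily 𝒜) :
    ∃ c : ℝ,
      (∃ N : ℕ, ∀ n : ℕ, N ≤ n → ∀ x : List Bool, x.length = n → ∀ d : ℝ,
        AlgStat.algNeighborhood V enc 𝒜 d x ⊆
          AlgStat.probNeighborhood V m enc 𝒜 (d + c * Real.logb 2 n) x) ∧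
      (∀ n : ℕ, 2 ≤ n → ∀ x : List Bool, x.length = n → ∀ d : ℝ,
        AlgStat.probNeighborhood V m enc 𝒜 d x ⊆
          AlgStat.algNeighborhood V enc 𝒜 (d + c * Real.logb 2 n) x) := by
  open AlgStat in
  obtain ⟨c₁, h₁⟩ := exists_modelSum_le hV hm.1 henc h𝒜
  obtain ⟨c₂, h₂⟩ := exists_modelWeight_le hV hm enc 𝒜
  obtain ⟨c₃, h₃⟩ := exists_modelWeight_le_of_pos hV hm henc h𝒜
  obtain ⟨N, hN⟩ := exists_better_model hV henc h𝒜
  have hS0 := modelSum_nonneg (V := V) hm.1.1 enc 𝒜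
  refine ⟨((c₁ + c₂ + c₃ : ℕ) : ℝ), ⟨max N 2, ?_⟩, ?_⟩
  · rintro n hn x rfl d y ⟨A, hA, hxA, hyA, hmin⟩
    have hn2 : 2 ≤ x.length := le_of_max_le_right hn
    have hn1 : (1 : ℝ) ≤ x.length := by exact_mod_cast (by omega : 1 ≤ x.length)
    -- `A` itself may be too complex to occur in the sums; `B` stands in for it in the numerator.
    obtain ⟨B, hB, hxB, hyB, hCB, hAB⟩ := hN _ (le_of_max_le_left hn) A hA x hxA y hyA
    have hwB := modelWeight_pos V enc ⟨x, hxB⟩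
    have hSx : 0 < modelSum V m enc 𝒜 x.length {x, x} := by
      refine (hS0 _ _).lt_of_ne' fun h0 => ?_
      have h := h₂ _ hn2 B hB hCB x hxB x hxB
      rw [h0, mul_zero] at h
      linarith
    -- `E` controls the denominator. Near-optimality of `A` is tested against all members of the
    -- slice, so `E` needs no complexity bound.
    obtain ⟨E, hE, hxE, -, hSE⟩ := h₁ _ x x hn2 hSx
    have hEA := (deficiency_le_iff ⟨x, hxA⟩ ⟨x, hxE⟩ d).1 (hmin E hE hxE)
    have hBS := h₂ _ hn2 B hB hCB x hxB y hyB
    show (2 : ℝ) ^ (-(d + _)) ≤ predictionProb V m enc 𝒜 y x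
    rw [predictionProb, ← Set.pair_eq_singleton x, le_div_iff₀ hSx, Real.rpow_neg (by norm_num),
      inv_mul_le_iff₀ (by positivity), rpow_add_mul_logb hn2]
    have h0 := hS0 x.length {x, y}
    calc modelSum V m enc 𝒜 x.length {x, x}
        ≤ (x.length : ℝ) ^ c₁ * (2 ^ d * ((x.length : ℝ) ^ c₂ *
            modelSum V m enc 𝒜 x.length {x, y})) :=
          hSE.trans (by gcongr; exact hEA.trans (by gcongr; exact hAB.trans hBS))
      _ = 2 ^ d * (x.length : ℝ) ^ (c₁ + c₂) * modelSum V m enc 𝒜 x.length {x, y} := by ring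
      _ ≤ 2 ^ d * (x.length : ℝ) ^ (c₁ + c₂ + c₃) * modelSum V m enc 𝒜 x.length {x, y} := by
          refine mul_le_mul_of_nonneg_right (mul_le_mul_of_nonneg_left
            (pow_le_pow_right₀ hn1 (by omega)) (by positivity)) h0
  · rintro n hn2 x rfl d y hy
    have hn1 : (1 : ℝ) ≤ x.length := by exact_mod_cast (by omega : 1 ≤ x.length)
    have hp : (2 : ℝ) ^ (-d) ≤ predictionProb V m enc 𝒜 y x := hy
    have hd : (0 : ℝ) < 2 ^ (-d) := by positivity
    rw [predictionProb, ← Set.pair_eq_singleton x] at hp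
    -- A zero denominator would make the quotient 0, below 2^(-d).
    have hSx : 0 < modelSum V m enc 𝒜 x.length {x, x} := by
      refine (hS0 _ _).lt_of_ne' fun h0 => ?_
      rw [h0, div_zero] at hp
      linarith
    rw [le_div_iff₀ hSx] at hp
    have hSxy : 0 < modelSum V m enc 𝒜 x.length {x, y} := (by positivity : (0 : ℝ) < _).trans_le hp
    rw [Real.rpow_neg (by norm_num), inv_mul_le_iff₀ (by positivity)] at hp
    -- `A` controls the numerator, and `h₃` bounds every competitor by the denominator.
    obtain ⟨A, hA, hxA, hyA, hSA⟩ := h₁ _ x y hn2 hSxy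
    refine ⟨A, hA, hxA, hyA, fun B hB hxB => (deficiency_le_iff ⟨x, hxA⟩ ⟨x, hxB⟩ _).2 ?_⟩
    rw [rpow_add_mul_logb hn2]
    have hwA := modelWeight_pos V enc ⟨x, hxA⟩
    calc modelWeight V enc B ≤ (x.length : ℝ) ^ c₃ * (2 ^ d * ((x.length : ℝ) ^ c₁ *
            modelWeight V enc A)) :=
          (h₃ _ hn2 x hSx B hB hxB).trans (by gcongr; exact hp.trans (by gcongr))
      _ = 2 ^ d * (x.length : ℝ) ^ (c₁ + c₃) * modelWeight V enc A := by ring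
      _ ≤ 2 ^ d * (x.length : ℝ) ^ (c₁ + c₂ + c₃) * modelWeight V enc A := by
          refine mul_le_mul_of_nonneg_right (mul_le_mul_of_nonneg_left
            (pow_le_pow_right₀ hn1 (by omega)) (by positivity)) hwA.le
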